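/- For an integer $\Delta\ge 4$ let $\lambda_c(\mathbb{T}_\Delta)=(\Delta-1)^{\Delta-1}/(\Delta-2)^{\Delta}$. Let $\mathcal{G}(n,\Delta)$ be the distribution over bipartite graphs on $V_1\cup V_2$, $|V_1|=|V_2|=n$, obtained as the union of $\Delta$ independent uniformly random perfect matchings between $V_1$ and $V_2$ (multiple edges being identified). For a graph $G$ and $\lambda>0$, let $\mathcal{I}(G)$ be the set of independent sets of $G$ and let $\mu$ be the Gibbs distribution on $\mathcal{I}(G)$, $\mu(I)=\lambda^{|I|}/\sum_{J\in\mathcal{I}(G)}\lambda^{|J|}$. For $\delta>0$ and $i\in\{1,2\}$ let \[\mathcal{I}_i^\delta=\{I\in\mathcal{I}(G): |I\cap V_i|>|I\cap V_{3-i}|+\delta n\},\qquad \mathcal{I}_B^\delta=\mathcal{I}(G)\setminus(\mathcal{I}_1^\delta\cup\mathcal{I}_2^\delta).\] The Glauber dynamics on $\mathcal{I}(G)$ is the Markov chain which, from a state $X$, chooses a uniformly random vertex $v$, sets $X'=X\cup\{v\}$ with probability $\lambda/(1+\lambda)$ and $X'=X\setminus\{v\}$ with probability $1/(1+\lambda)$,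 and moves to $X'$ if $X'\in\mathcal{I}(G)$ and stays at $X$ otherwise; $T_{\mathrm{mix}}$ is the least $T$ such that, from every initial state, the law after $T$ steps is within total variation distance $1/4$ of $\mu$. Theorem. There is a function $\varepsilon$ with $\varepsilon(\Delta)>0$ for all $\Delta\ge 4$, with $\varepsilon(\Delta)\ge\lambda_c(\mathbb{T}_\Delta)-\lambda_c(\mathbb{T}_{\Delta+1})$ for all $\Delta\ge 6$, $\varepsilon(5)\ge 0.402912$ and $\varepsilon(4)\ge 0.327887$, such that for every $\Delta\ge 4$ and every $\lambda$ with $\lambda_c(\mathbb{T}_\Delta)<\lambda<\lambda_c(\mathbb{T}_\Delta)+\varepsilon(\Delta)$ the following holds. There are $a>1$ and $\delta>0$ such that, with probability tending to $1$ as $n\to\infty$, for $G$ chosen from $\mathcal{G}(n,\Delta)$, \[\mu(\mathcal{I}_B^\delta)\le a^{-n}\min\{\mu(\mathcal{I}_1^\delta),\mu(\mathcal{I}_2^\delta)\}.\] Moreover the Glauber dynamics is torpidly mixing: there is $c>0$ such that, with probability tending to $1$ as $n\to\infty$, for $G$ chosen from $\mathcal{G}(n,\Delta)$, $T_{\mathrm{mix}}\ge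 e^{cn}$. -/

import Mathlib

/-- The critical activity for uniqueness of the hard-core model on the infinite `Δ`-regular tree,
`(Δ - 1) ^ (Δ - 1) / (Δ - 2) ^ Δ`. -/
noncomputable def HardCore.criticalActivity (Δ : ℕ) : ℝ :=
  ((Δ : ℝ) - 1) ^ (Δ - 1) / ((Δ : ℝ) - 2) ^ Δ

namespace HardCore

/-! ### The hard-core model and its Glauber dynamics on a finite graph -/

section Model

variable {V : Type*} [Fintype V] [DecidableEq V]

/-- The (finite) set of independent sets of a finite graph. -/
abbrev IndepSet (G : SimpleGraph V) : Type _ := {I : Finset V // G.IsIndepSet (I : Set V)}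

open Classical in
noncomputable instance instFintypeIndepSet (G : SimpleGraph V) : Fintype (IndepSet G) :=
  Subtype.fintype _

/-- The partition function `∑_I lam ^ |I|`. -/
noncomputable def partitionFunction (G : SimpleGraph V) (lam : ℝ) : ℝ :=
  ∑ I : IndepSet G, lam ^ I.1.card

/-- The Gibbs probability of a single independent set. -/
noncomputable def gibbs (G : SimpleGraph V) (lam : ℝ) (I : IndepSet G) : ℝ :=
  lam ^ I.1.card / partitionFunction G lam

open Classical in
/-- The Gibbs probability of a set of independent sets. -/
noncomputable def gibbsMass (G : SimpleGraph V) (lam : ℝ) (S : Set (IndepSet G)) : ℝ :=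
  ∑ I : IndepSet G with I ∈ S, gibbs G lam I

open Classical in
/-- The Metropolis-type filter: move to the proposed vertex set if it is independent,
otherwise stay. -/
noncomputable def accept (G : SimpleGraph V) (I : IndepSet G) (X : Finset V) : IndepSet G :=
  if h : G.IsIndepSet (X : Set V) then ⟨X, h⟩ else I

/-- The transition matrix of the Glauber dynamics: choose a uniformly random vertex `v`, propose
to add `v` with probability `lam / (1 + lam)` and to remove `v` with probability `1 / (1 + lam)`,
and carry out the proposal if the result is independent. -/
noncomputable def glauber (G : SimpleGraph V) (lam : ℝ) :
    Matrix (IndepSet G) (IndepSet G) ℝ :=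
  fun I J => ∑ v : V, (1 / (Fintype.card V : ℝ)) *
    (lam / (1 + lam) * (if accept G I (insert v I.1) = J then 1 else 0) +
      1 / (1 + lam) * (if accept G I (I.1.erase v) = J then 1 else 0))

/-- The total variation distance between the law of the Glauber dynamics after `T` steps from
`I` and the Gibbs distribution. -/
noncomputable def tvToGibbs (G : SimpleGraph V) (lam : ℝ) (T : ℕ) (I : IndepSet G) : ℝ :=
  (1 / 2) * ∑ J : IndepSet G, |(glauber G lam ^ T) I J - gibbs G lam J|

/-- The mixing time: the least number of steps after which, from every initial state, the chain is
within total variation distance `1 / 4` of the Gibbs distribution. -/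
noncomputable def mixingTime (G : SimpleGraph V) (lam : ℝ) : ℕ :=
  sInf {T : ℕ | ∀ I : IndepSet G, tvToGibbs G lam T I ≤ 1 / 4}

end Model

/-! ### Balanced and unbalanced independent sets of graphs on `n + n` vertices -/

/-- Independent sets biased towards the first side by more than `δ n` vertices. -/
def biasedLeft {n : ℕ} (G : SimpleGraph (Fin n ⊕ Fin n)) (δ : ℝ) : Set (IndepSet G) :=
  {I | (I.1.toLeft.card : ℝ) > I.1.toRight.card + δ * n}

/-- Independent sets biased towards the second side by more than `δ n` vertices. -/
def biasedRight {n : ℕ} (G : SimpleGraph (Fin n ⊕ Fin n)) (δ : ℝ) : Set (IndepSet G) :=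
  {I | (I.1.toRight.card : ℝ) > I.1.toLeft.card + δ * n}

/-- Nearly balanced independent sets. -/
def balanced {n : ℕ} (G : SimpleGraph (Fin n ⊕ Fin n)) (δ : ℝ) : Set (IndepSet G) :=
  {I | (I.1.toLeft.card : ℝ) ≤ I.1.toRight.card + δ * n ∧
    (I.1.toRight.card : ℝ) ≤ I.1.toLeft.card + δ * n}

/-! ### The union of `Δ` independent uniformly random perfect matchings -/

/-- The bipartite simple graph on `n + n` vertices which is the union of the perfect matchings
`i ↦ σ k i`, `k < Δ`. -/
def unionOfMatchings {n Δ : ℕ} (σ : Fin Δ → Equiv.Perm (Fin n)) :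
    SimpleGraph (Fin n ⊕ Fin n) where
  Adj x y := ∃ (k : Fin Δ) (i : Fin n), (x = Sum.inl i ∧ y = Sum.inr (σ k i)) ∨
    (x = Sum.inr (σ k i) ∧ y = Sum.inl i)
  symm := ⟨fun _ _ ⟨k, i, h⟩ => ⟨k, i, h.symm.imp And.symm And.symm⟩⟩
  loopless := ⟨fun _ ⟨_, _, h⟩ => by rcases h with ⟨rfl, h⟩ | ⟨rfl, h⟩ <;> cases h⟩

/-- The law of the union of `Δ` independent uniformly random perfect matchings between two
sets of `n` vertices, with multiple edges identified. -/
noncomputable def randomGraph (n Δ : ℕ) : PMF (SimpleGraph (Fin n ⊕ Fin n)) :=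
  (PMF.uniformOfFintype (Fin Δ → Equiv.Perm (Fin n))).map unionOfMatchings

/-- The property `Q` holds asymptotically almost surely, as `n → ∞`, for the union of `Δ`
random perfect matchings on `n + n` vertices. -/
def AsymptoticallyAlmostSurely (Δ : ℕ) (Q : ∀ n : ℕ, SimpleGraph (Fin n ⊕ Fin n) → Prop) : Prop :=
  Filter.Tendsto (fun n : ℕ => (randomGraph n Δ).toOuterMeasure {G | Q n G})
    Filter.atTop (nhds 1)

end HardCore

namespace HardCore

/-! ### Log-supermodular functions and sorted layers -/

/-! The two conclusions hold for every activity above `criticalActivity Δ`, already for `Δ ≥ 3`, so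
`ε` may be any sufficiently large function. No second moment is computed: the partition function of
every union of matchings, typical or not, is at least its Bethe value, and only first moments are
needed from above.

Lower bound. Replace every vertex by `k` layers and every edge by a permutation of the layers. Once
the right side is summed out, the weight of a lift is log-supermodular in the left configuration and
dominated by the product of the base weights of its sorted layers. By `sum_layers_le_pow`, the lift
has at most the `k`-th power of the base partition function (`sum_lift_le`). Averaging over all
lifts decouples the vertices (`pow_expectedCount_le`), and letting `k` tend to infinity at fixed
densities gives `exp_bethe_le_biPartition`.

Symmetry breaking. Above the critical activity no diagonal point maximizes the Bethe energy: it
increases along the diagonal up to `1 / Δ`, and beyond `1 / Δ` it is strictly convex in the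
transversal direction at the diagonal (`exists_lt_betheEnergy`). Hence a small field `s` on the left
makes left-biased densities win strictly, while `s` stays below the gap between the diagonal and the
maximum (`exists_field`).

Comparison. Let `M` be the maximal energy in the field. By Markov's inequality the sets that are not
left-biased contribute, in the field, exponentially less than `exp (n * M)`, so the left-biased ones
carry at least half of it. Removing the field costs at most `exp (n * s)`, and the balanced sets
without field are still exponentially below `exp (n * (M - s))`. Exchanging the sides treats the
right-biased sets (`card_exceptional_le`).

Mixing. One Glauber step cannot jump between the two biased families, so the balanced sets form a
bottleneck (`mixingTime_ge_of_bottleneck`). -/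

lemma prod_range_mul_le_of_antitone {r : ℕ → ℝ} (hr : ∀ i, 0 < r i) (ha : Antitone r)
    {l m : ℕ} (hlm : l ≤ m) (d : ℕ) :
    (∏ i ∈ Finset.range (m + d), r i) * ∏ i ∈ Finset.range l, r i ≤
      (∏ i ∈ Finset.range m, r i) * ∏ i ∈ Finset.range (l + d), r i := by
  rw [Finset.prod_range_add, Finset.prod_range_add]
  have h : ∏ x ∈ Finset.range d, r (m + x) ≤ ∏ x ∈ Finset.range d, r (l + x) :=
    Finset.prod_le_prod (fun i _ => (hr _).le) (fun i _ => ha (by omega))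
  have h1 : 0 ≤ (∏ i ∈ Finset.range m, r i) * ∏ i ∈ Finset.range l, r i :=
    mul_nonneg (Finset.prod_nonneg fun i _ => (hr _).le) (Finset.prod_nonneg fun i _ => (hr _).le)
  nlinarith [mul_le_mul_of_nonneg_left h h1]

/-- Entries on either side of `θ` are kept, and a pair of consecutive entries straddling `θ` is
replaced by `θ` and a number with the same product. Pulling two numbers together at constant product
lowers `(1 + ·) * (1 + ·)`. -/
lemma prod_sandwich_le {r : ℕ → ℝ} (hr : ∀ i, 0 < r i) (ha : Antitone r) {θ : ℝ} (hθ : 0 < θ)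
    (h0 : θ ≤ r 0) (K : ℕ) :
    (∏ m ∈ Finset.range K, (1 + max θ (r m) * min θ (r (m + 1)) / θ)) * (1 + max θ (r K)) ≤
      ∏ m ∈ Finset.range (K + 1), (1 + r m) := by
  induction K with
  | zero => simp [h0]
  | succ K ih =>
    rw [Finset.prod_range_succ, Finset.prod_range_succ _ (K + 1)]
    have hK := hr (K + 1)
    refine le_trans ?_ (mul_le_mul_of_nonneg_right ih (by positivity))
    rw [mul_assoc, mul_assoc]
    refine mul_le_mul_of_nonneg_left ?_ (Finset.prod_nonneg fun i _ => ?_)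
    · have hle := ha (Nat.le_succ K)
      rcases le_total θ (r (K + 1)) with h | h
      · rw [min_eq_left h, max_eq_right h, max_eq_right (h.trans hle),
          mul_div_assoc, div_self hθ.ne', mul_one]
      · rw [min_eq_right h, max_eq_left h]
        have hM : θ ≤ max θ (r K) := le_max_left _ _
        set M := max θ (r K)
        -- Same product and smaller sum, because `(M - θ) * (1 - r (K + 1) / θ) ≥ 0`.
        have e : M * r (K + 1) / θ * θ = M * r (K + 1) := by field_simp
        have hle2 : M * r (K + 1) / θ ≤ M := by
          rw [div_le_iff₀ hθ]; exact mul_le_mul_of_nonneg_left h (hθ.le.trans hM)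
        have hge2 : r (K + 1) ≤ M * r (K + 1) / θ := by
          rw [le_div_iff₀ hθ, mul_comm]; exact mul_le_mul_of_nonneg_right hM hK.le
        have e3 : M * r (K + 1) / θ - r (K + 1) = (M - θ) * (r (K + 1) / θ) := by
          field_simp
        have e4 : r (K + 1) / θ ≤ 1 := by rw [div_le_one hθ]; exact h
        nlinarith [mul_le_mul_of_nonneg_left e4 (sub_nonneg.2 hM)]
    · have := hr i; have := hr (i + 1); positivity

/-- A positive log-supermodular set function bounded by a log-concave function of the cardinality
has total mass at most that of the product function which is extremal for this bound. -/
theorem sum_powerset_le_of_logSupermodular {α : Type*} [DecidableEq α] (s : Finset α) :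
    ∀ (r : ℕ → ℝ) (C : ℝ) (γ : Finset α → ℝ), (∀ i, 0 < r i) → Antitone r → 0 < C →
      (∀ T ⊆ s, 0 < γ T) →
      (∀ T ⊆ s, ∀ U ⊆ s, γ T * γ U ≤ γ (T ∩ U) * γ (T ∪ U)) →
      (∀ T ⊆ s, γ T ≤ C * ∏ i ∈ Finset.range T.card, r i) →
      ∑ T ∈ s.powerset, γ T ≤ C * ∏ i ∈ Finset.range s.card, (1 + r i) := by
  induction s using Finset.induction_on with
  | empty =>
    intro r C γ _ _ _ _ _ hb
    simpa using hb ∅ (Finset.Subset.refl _)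
  | insert x s hx ih =>
    intro r C γ hr ha hC hpos hsup hb
    set c : ℕ → ℝ := fun m => C * ∏ i ∈ Finset.range m, r i with hc
    have hcpos : ∀ m, 0 < c m := fun m => mul_pos hC (Finset.prod_pos fun i _ => hr i)
    have hcs : ∀ m, c (m + 1) = c m * r m := fun m => by
      simp only [hc, Finset.prod_range_succ, mul_assoc]
    have hss : ∀ {T}, T ⊆ s → T ⊆ insert x s := fun h => h.trans (Finset.subset_insert _ _)
    have hsi : ∀ {T}, T ⊆ s → insert x T ⊆ insert x s := fun h => Finset.insert_subset_insert _ h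
    have hxn : ∀ {T}, T ⊆ s → x ∉ T := fun h hh => hx (h hh)
    have hci : ∀ {T}, T ⊆ s → (insert x T).card = T.card + 1 := fun h =>
      Finset.card_insert_of_notMem (hxn h)
    -- `θ₀` is the largest value, relative to the bound, of a set containing `x`. Supermodularity
    -- against its maximizer `T0` turns it into an upper bound for all sets avoiding `x`.
    obtain ⟨T0, hT0, hmax⟩ := Finset.exists_max_image s.powerset
      (fun T => γ (insert x T) / c T.card) ⟨∅, Finset.empty_mem_powerset _⟩
    rw [Finset.mem_powerset] at hT0
    set θ₀ := γ (insert x T0) / c T0.card with hθ₀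
    have hθ₀pos : 0 < θ₀ := div_pos (hpos _ (hsi hT0)) (hcpos _)
    -- Raising `θ₀` to at least `r s.card` makes the last factor in `prod_sandwich_le` equal to `1 +
    -- θ`.
    set θ := max θ₀ (r s.card) with hθ
    have hθpos : 0 < θ := lt_max_of_lt_left hθ₀pos
    have hlow : ∀ T ⊆ s, γ (insert x T) ≤ θ * c T.card := by
      intro T hT
      have := hmax T (Finset.mem_powerset.2 hT)
      rw [div_le_iff₀ (hcpos _)] at this
      exact this.trans (mul_le_mul_of_nonneg_right (le_max_left _ _) (hcpos _).le)
    have hup : ∀ S ⊆ s, θ * γ S ≤ c (S.card + 1) := by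
      intro S hS
      rw [hθ, max_mul_of_nonneg _ _ (hpos _ (hss hS)).le]
      refine max_le ?_ ?_
      · rw [hθ₀, div_mul_eq_mul_div, div_le_iff₀ (hcpos _)]
        refine (hsup _ (hsi hT0) _ (hss hS)).trans ?_
        have e1 : insert x T0 ∩ S = T0 ∩ S := by
          rw [Finset.insert_inter_of_notMem (hxn hS)]
        have e2 : insert x T0 ∪ S = insert x (T0 ∪ S) := Finset.insert_union _ _ _
        rw [e1, e2]
        have hi : T0 ∩ S ⊆ s := Finset.inter_subset_left.trans hT0
        have hu : T0 ∪ S ⊆ s := Finset.union_subset hT0 hS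
        have b1 := hb _ (hss hi)
        have b2 := hb _ (hsi hu)
        rw [hci hu] at b2
        refine (mul_le_mul b1 b2 (hpos _ (hsi hu)).le (hcpos _).le).trans ?_
        have hcard := Finset.card_union_add_card_inter T0 S
        have hl : (T0 ∩ S).card ≤ T0.card := Finset.card_le_card Finset.inter_subset_left
        have hl' : (T0 ∩ S).card ≤ S.card := Finset.card_le_card Finset.inter_subset_right
        have key := prod_range_mul_le_of_antitone hr ha hl (S.card + 1 - (T0 ∩ S).card)
        have q1 : T0.card + (S.card + 1 - (T0 ∩ S).card) = (T0 ∪ S).card + 1 := by omega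
        have q2 : (T0 ∩ S).card + (S.card + 1 - (T0 ∩ S).card) = S.card + 1 := by omega
        rw [q1, q2] at key
        simp only [hc]
        nlinarith [mul_le_mul_of_nonneg_left key (mul_pos hC hC).le]
      · rw [hcs, mul_comm]
        exact mul_le_mul (hb _ (hss hS)) (ha (Finset.card_le_card hS)) (hr _).le (hcpos _).le
    have hθr : θ ≤ r 0 := by
      refine max_le ?_ (ha (Nat.zero_le _))
      rw [hθ₀, div_le_iff₀ (hcpos _)]
      have := hb _ (hsi hT0)
      rw [hci hT0] at this
      refine this.trans ?_
      change c (T0.card + 1) ≤ _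
      rw [hcs, mul_comm]
      exact mul_le_mul_of_nonneg_right (ha (Nat.zero_le _)) (hcpos _).le
    -- Both `θ * γ T` and `γ (insert x T)` are at most `c T.card * min θ (r T.card)`, and `r'` is
    -- the sequence of successive ratios of this new bound.
    set r' : ℕ → ℝ := fun m => max θ (r m) * min θ (r (m + 1)) / θ with hr'
    have hprod : ∀ m, c m * min θ (r m) = C * θ * ∏ i ∈ Finset.range m, r' i := by
      intro m
      induction m with
      | zero => simp [hc, min_eq_left hθr]
      | succ m ihm =>
        rw [Finset.prod_range_succ, ← mul_assoc, ← ihm, hcs]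
        have : max θ (r m) * min θ (r m) = θ * r m := by
          rw [max_mul_min]
        simp only [hr']
        field_simp
        linear_combination (-(min θ (r (m+1)) * c m)) * this
    rw [Finset.sum_powerset_insert hx, ← Finset.sum_add_distrib]
    have hmin : ∀ m, 0 < min θ (r m) := fun m => lt_min hθpos (hr m)
    have := ih r' (C * (1 + θ)) (fun T => γ T + γ (insert x T))
      (fun i => by
        have h1 := hmin (i + 1)
        have h2 : 0 < max θ (r i) := lt_max_of_lt_left hθpos
        simp only [hr']; positivity)
      (fun i j hij => by
        simp only [hr']
        have h1 := (hmin (j + 1)).le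
        have h2 : 0 < max θ (r i) := lt_max_of_lt_left hθpos
        gcongr
        · exact ha hij
        · exact ha (by omega))
      (by positivity)
      (fun T hT => add_pos (hpos _ (hss hT)) (hpos _ (hsi hT)))
      ?_ ?_
    · refine this.trans ?_
      rw [Finset.card_insert_of_notMem hx]
      have h3 := prod_sandwich_le hr ha hθpos hθr s.card
      rw [max_eq_left (le_max_right θ₀ (r s.card))] at h3
      have := mul_le_mul_of_nonneg_left h3 hC.le
      refine le_trans (le_of_eq ?_) this
      simp only [hr']
      ring
    · intro T hT U hU
      -- Summing over whether `x` is present preserves log-supermodularity.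
      have h4 := four_functions_theorem_univ (α := Bool) (β := ℝ)
        (fun b => if b then γ (insert x T) else γ T) (fun b => if b then γ (insert x U) else γ U)
        (fun b => if b then γ (insert x (T ∩ U)) else γ (T ∩ U))
        (fun b => if b then γ (insert x (T ∪ U)) else γ (T ∪ U))
      have hi : T ∩ U ⊆ s := Finset.inter_subset_left.trans hT
      have hu : T ∪ U ⊆ s := Finset.union_subset hT hU
      have h5 := h4 (fun b => by cases b <;> simp [(hpos _ (hss hT)).le, (hpos _ (hsi hT)).le])
        (fun b => by cases b <;> simp [(hpos _ (hss hU)).le, (hpos _ (hsi hU)).le])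
        (fun b => by cases b <;> simp [(hpos _ (hss hi)).le, (hpos _ (hsi hi)).le])
        (fun b => by cases b <;> simp [(hpos _ (hss hu)).le, (hpos _ (hsi hu)).le])
        (fun a b => by
          cases a <;> cases b
          · simpa using hsup _ (hss hT) _ (hss hU)
          · have := hsup _ (hss hT) _ (hsi hU)
            rw [Finset.inter_insert_of_notMem (hxn hT), Finset.union_insert] at this
            simpa using this
          · have := hsup _ (hsi hT) _ (hss hU)
            rw [Finset.insert_inter_of_notMem (hxn hU), Finset.insert_union] at this
            simpa using this
          · have := hsup _ (hsi hT) _ (hsi hU)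
            rw [← Finset.insert_inter_distrib, ← Finset.insert_union_distrib] at this
            simpa using this)
      simp only [Fintype.sum_bool, if_true] at h5
      simp only [Bool.false_eq_true, if_false] at h5
      linarith
    · intro T hT
      have h1 : γ T * θ ≤ c T.card * min θ (r T.card) := by
        rw [mul_min_of_nonneg _ _ (hcpos _).le, ← hcs]
        exact le_min (mul_le_mul_of_nonneg_right (hb _ (hss hT)) hθpos.le)
          (by rw [mul_comm]; exact hup T hT)
      have h2 : γ (insert x T) ≤ c T.card * min θ (r T.card) := by
        rw [mul_min_of_nonneg _ _ (hcpos _).le, ← hcs]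
        refine le_min (by rw [mul_comm]; exact hlow T hT) ?_
        have := hb _ (hsi hT)
        rwa [hci hT] at this
      rw [hprod] at h1 h2
      have h1' : γ T ≤ C * ∏ i ∈ Finset.range T.card, r' i := by
        have : γ T * θ ≤ (C * ∏ i ∈ Finset.range T.card, r' i) * θ := by linarith
        exact le_of_mul_le_mul_right this hθpos
      linarith

/-- Marginals of log-supermodular functions are log-supermodular; this lets the induction over
vertices peel off one coordinate. -/
lemma logSupermodular_sum_fst {α β : Type*} [DistribLattice α] [Fintype α] [DecidableEq α]
    [Lattice β] {g : α → β → ℝ} (hg : ∀ a b, 0 ≤ g a b)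
    (h : ∀ a b a' b', g a b * g a' b' ≤ g (a ⊓ a') (b ⊓ b') * g (a ⊔ a') (b ⊔ b')) (b b' : β) :
    (∑ a, g a b) * ∑ a, g a b' ≤ (∑ a, g a (b ⊓ b')) * ∑ a, g a (b ⊔ b') :=
  four_functions_theorem_univ _ _ _ _ (fun a => hg a _) (fun a => hg a _) (fun a => hg a _)
    (fun a => hg a _) fun a a' => h a b a' b'

/-- A log-supermodular function on `k` layers, dominated by the product over the sorted layers of
a one-layer log-supermodular function, has total mass at most the `k`-th power of the one-layer
mass. -/
theorem sum_layers_le_pow {k : ℕ} : ∀ {n : ℕ} (f : (Fin n → Bool) → ℝ)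
    (g : (Fin n → Finset (Fin k)) → ℝ), (∀ x, 0 < f x) → (∀ S, 0 < g S) →
    (∀ x y, f x * f y ≤ f (x ⊓ y) * f (x ⊔ y)) →
    (∀ S T, g S * g T ≤ g (S ⊓ T) * g (S ⊔ T)) →
    (∀ S, g S ≤ ∏ i ∈ Finset.range k, f (fun u => decide (i < (S u).card))) →
    ∑ S, g S ≤ (∑ x, f x) ^ k := by
  intro n
  induction n with
  | zero =>
    intro f g _ _ _ _ h
    rw [Fintype.sum_unique, Fintype.sum_unique]
    refine (h _).trans (le_of_eq ?_)
    rw [Finset.prod_congr rfl (fun i _ => congrArg f (Subsingleton.elim _ default)),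
      Finset.prod_const, Finset.card_range]
    exact congrArg (f · ^ k) (Subsingleton.elim _ _)
  | succ n ih =>
    intro f g hf hg hfs hgs h
    have ef : ∑ x, f x = ∑ x : Fin n → Bool, ∑ b : Bool, f (Fin.cons b x) := by
      rw [← (Fin.consEquiv (fun _ => Bool)).sum_comp, Fintype.sum_prod_type_right]; rfl
    have eg : ∑ S, g S = ∑ S : Fin n → Finset (Fin k), ∑ T : Finset (Fin k), g (Fin.cons T S) := by
      rw [← (Fin.consEquiv (fun _ => Finset (Fin k))).sum_comp, Fintype.sum_prod_type_right]; rfl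
    have cinf : ∀ {β : Type} [Lattice β] (a a' : β) (x y : Fin n → β),
        (Fin.cons a x : Fin (n + 1) → β) ⊓ (Fin.cons a' y : Fin (n + 1) → β) =
          Fin.cons (a ⊓ a') (x ⊓ y) := by
      intro β _ a a' x y
      funext i; refine Fin.cases ?_ (fun i => ?_) i <;> simp
    have csup : ∀ {β : Type} [Lattice β] (a a' : β) (x y : Fin n → β),
        (Fin.cons a x : Fin (n + 1) → β) ⊔ (Fin.cons a' y : Fin (n + 1) → β) =
          Fin.cons (a ⊔ a') (x ⊔ y) := by
      intro β _ a a' x y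
      funext i; refine Fin.cases ?_ (fun i => ?_) i <;> simp
    rw [ef, eg]
    refine ih (fun x => ∑ b : Bool, f (Fin.cons b x))
      (fun S => ∑ T : Finset (Fin k), g (Fin.cons T S))
      (fun x => Finset.sum_pos (fun b _ => hf _) Finset.univ_nonempty)
      (fun S => Finset.sum_pos (fun b _ => hg _) Finset.univ_nonempty)
      (fun x y => logSupermodular_sum_fst (g := fun b x => f (Fin.cons b x)) (fun _ _ => (hf _).le)
        (fun a b a' b' => by simpa only [cinf, csup] using hfs (Fin.cons a b) (Fin.cons a' b')) x y)
      (fun x y => logSupermodular_sum_fst (g := fun b x => g (Fin.cons b x)) (fun _ _ => (hg _).le)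
        (fun a b a' b' => by simpa only [cinf, csup] using hgs (Fin.cons a b) (Fin.cons a' b')) x y)
      ?_
    intro S
    -- The sorted layers `z i` decrease in `i`, so by supermodularity the odds `b i / a i` of the
    -- peeled vertex do too. This is the monotonicity required by the one-vertex bound.
    set z : ℕ → Fin n → Bool := fun i u => decide (i < (S u).card) with hz
    have hzanti : Antitone z := by
      intro i j hij u
      simp only [hz]
      by_cases hj : j < (S u).card
      · simp [hj, hij.trans_lt hj]
      · simp [hj]
    set a : ℕ → ℝ := fun i => f (Fin.cons false (z i))
    set b : ℕ → ℝ := fun i => f (Fin.cons true (z i))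
    have ha : ∀ i, 0 < a i := fun i => hf _
    have hb : ∀ i, 0 < b i := fun i => hf _
    have key := sum_powerset_le_of_logSupermodular (Finset.univ : Finset (Fin k))
      (fun i => b i / a i) (∏ i ∈ Finset.range k, a i) (fun T => g (Fin.cons T S))
      (fun i => div_pos (hb i) (ha i))
      (fun i j hij => by
        rw [div_le_div_iff₀ (ha j) (ha i)]
        have h1 := hfs (Fin.cons true (z j)) (Fin.cons false (z i))
        rw [cinf, csup, inf_eq_left.2 (hzanti hij), sup_eq_right.2 (hzanti hij)] at h1
        have h2 : (true ⊓ false) = false := rfl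
        have h3 : (true ⊔ false) = true := rfl
        rw [h2, h3] at h1
        change b j * a i ≤ b i * a j
        change b j * a i ≤ a j * b i at h1
        linarith)
      (Finset.prod_pos fun i _ => ha i) (fun T _ => hg _)
      (fun T _ U _ => by
        have := hgs (Fin.cons T S) (Fin.cons U S)
        rw [cinf, csup, inf_idem, sup_idem] at this
        exact this)
      (fun T _ => by
        refine (h (Fin.cons T S)).trans (le_of_eq ?_)
        have hTk : T.card ≤ k := by simpa using Finset.card_le_univ T
        have e : ∀ i ∈ Finset.range k, f (fun u =>
            decide (i < ((Fin.cons T S : Fin (n + 1) → Finset (Fin k)) u).card)) =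
            a i * (if i < T.card then b i / a i else 1) := by
          intro i _
          have : (fun u => decide (i < ((Fin.cons T S : Fin (n + 1) → Finset (Fin k)) u).card)) =
              Fin.cons (decide (i < T.card)) (z i) := by
            funext u; refine Fin.cases ?_ (fun u => ?_) u <;> simp [hz]
          rw [this]
          split_ifs with hi
          · rw [mul_div_cancel₀ _ (ha i).ne']; simp [hi, b]
          · simp [hi, a]
        rw [Finset.prod_congr rfl e, Finset.prod_mul_distrib, ← Finset.prod_filter]
        congr 2
        ext i; simp; omega)
    rw [Finset.powerset_univ, Finset.card_univ, Fintype.card_fin] at key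
    refine key.trans (le_of_eq ?_)
    rw [← Finset.prod_mul_distrib]
    refine Finset.prod_congr rfl fun i _ => ?_
    rw [Fintype.sum_bool]
    have := (ha i).ne'
    change a i * (1 + b i / a i) = b i + a i
    field_simp
    ring

end HardCore

namespace HardCore

/-! ### Permutations avoiding a set -/

/-- Composition with a permutation carrying `B` to `B'` is a bijection between the two families. -/
lemma card_perm_avoid_congr {k : ℕ} (A B B' : Finset (Fin k)) (h : B.card = B'.card) :
    (Finset.univ.filter fun π : Equiv.Perm (Fin k) => Disjoint B (A.map π.toEmbedding)).card =
      (Finset.univ.filter fun π : Equiv.Perm (Fin k) =>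
        Disjoint B' (A.map π.toEmbedding)).card := by
  obtain ⟨ρ, hρ⟩ : ∃ ρ : Equiv.Perm (Fin k), B.map ρ.toEmbedding = B' := by
    have e : {x // x ∈ B} ≃ {x // x ∈ B'} := Fintype.equivOfCardEq (by simpa using h)
    refine ⟨e.extendSubtype, ?_⟩
    refine Finset.eq_of_subset_of_card_le ?_ (by simp [h])
    intro x hx
    obtain ⟨y, hy, rfl⟩ := Finset.mem_map.1 hx
    exact Equiv.extendSubtype_mem e y hy
  refine Finset.card_bij (fun π _ => π.trans ρ) ?_ ?_ ?_
  · intro π hπ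
    simp only [Finset.mem_filter, Finset.mem_univ, true_and] at hπ ⊢
    rw [← hρ, Equiv.trans_toEmbedding, ← Finset.map_map, Finset.disjoint_map]
    exact hπ
  · intro π _ π' _ hh
    ext x
    have := Equiv.congr_fun hh x
    simpa using congrArg Fin.val (ρ.injective this)
  · intro π hπ
    refine ⟨π.trans ρ.symm, ?_, ?_⟩
    · simp only [Finset.mem_filter, Finset.mem_univ, true_and] at hπ ⊢
      rw [← Finset.disjoint_map ρ.toEmbedding, Finset.map_map, ← Equiv.trans_toEmbedding, hρ]
      simpa [Equiv.trans_assoc] using hπ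
    · simp [Equiv.trans_assoc]

/-- Double counting: the number of permutations which map `A` off `B`. -/
lemma card_perm_avoid_mul_choose {k : ℕ} (A B : Finset (Fin k)) :
    (Finset.univ.filter fun π : Equiv.Perm (Fin k) =>
      Disjoint B (A.map π.toEmbedding)).card * k.choose B.card =
      k.factorial * (k - A.card).choose B.card := by
  have h1 : ∑ B' ∈ Finset.powersetCard B.card (Finset.univ : Finset (Fin k)),
      (Finset.univ.filter fun π : Equiv.Perm (Fin k) =>
        Disjoint B' (A.map π.toEmbedding)).card =
      (Finset.univ.filter fun π : Equiv.Perm (Fin k) =>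
        Disjoint B (A.map π.toEmbedding)).card * k.choose B.card := by
    rw [Finset.sum_congr rfl (fun B' hB' => card_perm_avoid_congr A B' B
      (Finset.mem_powersetCard.1 hB').2), Finset.sum_const, Finset.card_powersetCard,
      Finset.card_univ, Fintype.card_fin, smul_eq_mul, mul_comm]
  rw [← h1]
  simp only [Finset.card_filter]
  rw [Finset.sum_comm]
  have h2 : ∀ π : Equiv.Perm (Fin k),
      (∑ B' ∈ Finset.powersetCard B.card (Finset.univ : Finset (Fin k)),
        if Disjoint B' (A.map π.toEmbedding) then 1 else 0) = (k - A.card).choose B.card := by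
    intro π
    rw [← Finset.card_filter]
    have : (Finset.powersetCard B.card (Finset.univ : Finset (Fin k))).filter
        (fun B' => Disjoint B' (A.map π.toEmbedding)) =
        Finset.powersetCard B.card (A.map π.toEmbedding)ᶜ := by
      ext B'
      simp only [Finset.mem_filter, Finset.mem_powersetCard, Finset.subset_univ, true_and,
        Finset.subset_compl_iff_disjoint_right]
      tauto
    rw [this, Finset.card_powersetCard, Finset.card_compl, Finset.card_map, Fintype.card_fin]
  rw [Finset.sum_congr rfl (fun π _ => h2 π), Finset.sum_const, Finset.card_univ,
    Fintype.card_perm, Fintype.card_fin, smul_eq_mul]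

/-- The probability that a random permutation maps a given `a`-set off a given `b`-set. -/
noncomputable def avoidProb (k a b : ℕ) : ℝ := ((k - a).choose b : ℝ) / (k.choose b : ℝ)

lemma card_perm_avoid {k : ℕ} (A B : Finset (Fin k)) :
    ((Finset.univ.filter fun π : Equiv.Perm (Fin k) =>
      Disjoint B (A.map π.toEmbedding)).card : ℝ) = k.factorial * avoidProb k A.card B.card := by
  have hB : B.card ≤ k := by simpa using Finset.card_le_univ B
  have hpos : (0 : ℝ) < k.choose B.card := by exact_mod_cast Nat.choose_pos hB
  rw [avoidProb, ← mul_div_assoc, eq_div_iff hpos.ne']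
  exact_mod_cast card_perm_avoid_mul_choose A B

/-- The expected number of independent sets with `a` and `b` vertices on the two sides of the union
of `Δ` random perfect matchings on `k + k` vertices. -/
noncomputable def expectedCount (Δ k a b : ℕ) : ℝ :=
  k.choose a * (k.choose b * avoidProb k a b ^ Δ)

/-! ### The two-activity partition function and lifts -/

section Lift

variable {n Δ : ℕ}

/-- No matching maps `A` into `B`. -/
def Compat (σ : Fin Δ → Equiv.Perm (Fin n)) (A B : Finset (Fin n)) : Prop :=
  ∀ κ, Disjoint B (A.map (σ κ).toEmbedding)

noncomputable instance (σ : Fin Δ → Equiv.Perm (Fin n)) (A B : Finset (Fin n)) :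
    Decidable (Compat σ A B) := Classical.dec _

/-- The partition function with activities `l₁`, `l₂` on the two sides. -/
noncomputable def biPartition (σ : Fin Δ → Equiv.Perm (Fin n)) (l₁ l₂ : ℝ) : ℝ :=
  ∑ A : Finset (Fin n), ∑ B : Finset (Fin n),
    if Compat σ A B then l₁ ^ A.card * l₂ ^ B.card else 0

lemma sum_disjoint_pow {m : ℕ} (U : Finset (Fin m)) (l : ℝ) (hl : 1 + l ≠ 0) :
    (∑ T : Finset (Fin m), if Disjoint T U then l ^ T.card else 0) =
      (1 + l) ^ m * (1 + l)⁻¹ ^ U.card := by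
  rw [← Finset.sum_filter]
  have : (Finset.univ.filter fun T : Finset (Fin m) => Disjoint T U) = Uᶜ.powerset := by
    ext T; simp [Finset.subset_compl_iff_disjoint_right]
  rw [this]
  have h := Finset.sum_pow_mul_eq_add_pow l 1 Uᶜ
  simp only [one_pow, mul_one] at h
  rw [h, Finset.card_compl, Fintype.card_fin, add_comm l 1, inv_pow]
  exact pow_sub₀ _ hl (by simpa using Finset.card_le_univ U)

/-- The neighbourhood in the lift: the layers over the right vertex `v` which are adjacent to the
layers in `S`. -/
def liftNbhd {k : ℕ} (σ : Fin Δ → Equiv.Perm (Fin n)) (t : Fin Δ → Equiv.Perm (Fin k))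
    (S : Fin n → Finset (Fin k)) (v : Fin n) : Finset (Fin k) :=
  Finset.univ.biUnion fun κ => (S ((σ κ).symm v)).map (t κ).toEmbedding

lemma disjoint_liftNbhd {k : ℕ} {σ : Fin Δ → Equiv.Perm (Fin n)} {t : Fin Δ → Equiv.Perm (Fin k)}
    {S : Fin n → Finset (Fin k)} {v : Fin n} {T : Finset (Fin k)} :
    Disjoint T (liftNbhd σ t S v) ↔
      ∀ κ, Disjoint T ((S ((σ κ).symm v)).map (t κ).toEmbedding) := by
  simp [liftNbhd, Finset.disjoint_biUnion_right]

/-- Given the left configuration, the right vertices are independent: each contributes `1 + l₂` if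
free and `1` if it has an occupied neighbour. -/
lemma biPartition_eq (σ : Fin Δ → Equiv.Perm (Fin n)) (l₁ l₂ : ℝ) (h₂ : 0 < l₂) :
    biPartition σ l₁ l₂ = (1 + l₂) ^ n * ∑ x : Fin n → Bool,
      l₁ ^ (Finset.univ.filter fun u => x u).card *
        ∏ v : Fin n, (1 + l₂)⁻¹ ^ (if ∃ κ, x ((σ κ).symm v) then 1 else 0) := by
  have h1 : ∀ A : Finset (Fin n), (∑ B : Finset (Fin n),
      if Compat σ A B then l₁ ^ A.card * l₂ ^ B.card else 0) =
      (1 + l₂) ^ n * (l₁ ^ A.card *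
        (1 + l₂)⁻¹ ^ (Finset.univ.biUnion fun κ => A.map (σ κ).toEmbedding).card) := by
    intro A
    rw [mul_left_comm, ← sum_disjoint_pow _ _ (by positivity), Finset.mul_sum]
    refine Finset.sum_congr rfl fun B _ => ?_
    rw [mul_ite, mul_zero]
    refine if_congr ?_ rfl rfl
    simp [Compat, Finset.disjoint_biUnion_right]
  rw [biPartition, Finset.sum_congr rfl (fun A _ => h1 A), ← Finset.mul_sum]
  congr 1
  symm
  refine Finset.sum_bij' (fun x _ => Finset.univ.filter fun u => x u)
    (fun A _ => fun u => decide (u ∈ A)) ?_ ?_ ?_ ?_ ?_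
  · simp
  · simp
  · intro x _; funext u; simp
  · intro A _; ext u; simp
  · intro x _
    congr 1
    rw [Finset.prod_pow_eq_pow_sum, ← Finset.card_filter]
    congr 2
    ext v
    simp only [Finset.mem_filter, Finset.mem_univ, true_and, Finset.mem_biUnion, Finset.mem_map,
      Equiv.coe_toEmbedding]
    refine exists_congr fun κ => ⟨fun h => ⟨_, h, by simp⟩, ?_⟩
    rintro ⟨u, hu, rfl⟩
    simpa using hu

lemma pow_mul_pow_le_of_submodular {p : ℝ} (h0 : 0 < p) (h1 : p ≤ 1) {a b c d : ℕ}
    (h : c + d ≤ a + b) : p ^ a * p ^ b ≤ p ^ c * p ^ d := by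
  rw [← pow_add, ← pow_add]
  exact pow_le_pow_of_le_one h0.le h1 h

/-- Every lift has at most the partition function of the trivial lift. -/
theorem sum_lift_le {k : ℕ} (σ : Fin Δ → Equiv.Perm (Fin n))
    (τ : Fin n → Fin Δ → Equiv.Perm (Fin k)) {l₁ l₂ : ℝ} (h₁ : 0 < l₁) (h₂ : 0 < l₂) :
    ∑ S : Fin n → Finset (Fin k), l₁ ^ (∑ u, (S u).card) *
      ∏ v, (∑ T : Finset (Fin k), if Disjoint T (liftNbhd σ (τ v) S v) then l₂ ^ T.card else 0) ≤
      biPartition σ l₁ l₂ ^ k := by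
  set p : ℝ := (1 + l₂)⁻¹ with hp
  have hp0 : 0 < p := by positivity
  have hp1 : p ≤ 1 := inv_le_one_of_one_le₀ (by linarith)
  -- The right side is summed out, leaving a factor `p` per blocked right vertex or layer.
  -- Neighbourhood size is submodular and `p ≤ 1`, so these weights are log-supermodular.
  have key := sum_layers_le_pow (k := k)
    (fun x : Fin n → Bool => l₁ ^ (Finset.univ.filter fun u => x u).card *
        ∏ v : Fin n, p ^ (if ∃ κ, x ((σ κ).symm v) then 1 else 0))
    (fun S => l₁ ^ (∑ u, (S u).card) * ∏ v, p ^ (liftNbhd σ (τ v) S v).card)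
    (fun x => by positivity) (fun S => by positivity) ?_ ?_ ?_
  · rw [biPartition_eq σ l₁ l₂ h₂, mul_pow]
    refine le_trans (le_of_eq ?_) (mul_le_mul_of_nonneg_left key (by positivity))
    rw [Finset.mul_sum]
    refine Finset.sum_congr rfl fun S _ => ?_
    rw [Finset.prod_congr rfl (fun v _ => sum_disjoint_pow _ _ (by positivity)),
      Finset.prod_mul_distrib, Finset.prod_const, Finset.card_univ, Fintype.card_fin, ← pow_mul,
      ← pow_mul, mul_comm k n, mul_left_comm]
  · intro x y
    refine le_trans (le_of_eq (mul_mul_mul_comm _ _ _ _))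
      (le_trans ?_ (le_of_eq (mul_mul_mul_comm _ _ _ _)))
    rw [← Finset.prod_mul_distrib, ← Finset.prod_mul_distrib]
    refine mul_le_mul (le_of_eq ?_) (Finset.prod_le_prod (fun v _ => by positivity) fun v _ =>
      pow_mul_pow_le_of_submodular hp0 hp1 ?_) (by positivity) (by positivity)
    · rw [← pow_add, ← pow_add, ← Finset.card_inter_add_card_union]
      congr 3
      · ext u; simp
      · ext u; simp
    · by_cases hx : ∃ κ, x ((σ κ).symm v) <;> by_cases hy : ∃ κ, y ((σ κ).symm v)
      · simp only [hx, hy, if_true]; split_ifs <;> omega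
      · have : ¬ ∃ κ, (x ⊓ y) ((σ κ).symm v) := by
          rintro ⟨κ, hκ⟩
          exact hy ⟨κ, by simp at hκ; exact hκ.2⟩
        rw [if_neg this]; simp only [hx, hy, if_true, if_false]; split_ifs <;> omega
      · have : ¬ ∃ κ, (x ⊓ y) ((σ κ).symm v) := by
          rintro ⟨κ, hκ⟩
          exact hx ⟨κ, by simp at hκ; exact hκ.1⟩
        rw [if_neg this]; simp only [hx, hy, if_true, if_false]; split_ifs <;> omega
      · have h3 : ¬ ∃ κ, (x ⊓ y) ((σ κ).symm v) := by
          rintro ⟨κ, hκ⟩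
          exact hx ⟨κ, by simp at hκ; exact hκ.1⟩
        have h4 : ¬ ∃ κ, (x ⊔ y) ((σ κ).symm v) := by
          rintro ⟨κ, hκ⟩
          simp at hκ
          rcases hκ with hκ | hκ
          · exact hx ⟨κ, hκ⟩
          · exact hy ⟨κ, hκ⟩
        rw [if_neg h3, if_neg h4]; simp
  · intro S T
    refine le_trans (le_of_eq (mul_mul_mul_comm _ _ _ _))
      (le_trans ?_ (le_of_eq (mul_mul_mul_comm _ _ _ _)))
    rw [← Finset.prod_mul_distrib, ← Finset.prod_mul_distrib]
    refine mul_le_mul (le_of_eq ?_) (Finset.prod_le_prod (fun v _ => by positivity) fun v _ =>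
      pow_mul_pow_le_of_submodular hp0 hp1 ?_) (by positivity) (by positivity)
    · rw [← pow_add, ← pow_add, ← Finset.sum_add_distrib, ← Finset.sum_add_distrib]
      congr 1
      exact Finset.sum_congr rfl fun u _ => (Finset.card_inter_add_card_union (S u) (T u)).symm
    · rw [← Finset.card_inter_add_card_union (liftNbhd σ (τ v) S v)]
      refine add_le_add (Finset.card_le_card ?_) (Finset.card_le_card ?_)
      · intro j hj
        simp only [liftNbhd, Finset.mem_inter, Finset.mem_biUnion, Finset.mem_map, Finset.mem_univ,
          true_and, Pi.inf_apply, Finset.inf_eq_inter] at hj ⊢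
        obtain ⟨κ, i, ⟨hi, hi'⟩, rfl⟩ := hj
        exact ⟨⟨κ, i, hi, rfl⟩, ⟨κ, i, hi', rfl⟩⟩
      · intro j hj
        simp only [liftNbhd, Finset.mem_union, Finset.mem_biUnion, Finset.mem_map, Finset.mem_univ,
          true_and, Pi.sup_apply, Finset.sup_eq_union] at hj ⊢
        obtain ⟨κ, i, hi | hi, rfl⟩ := hj
        · exact Or.inl ⟨κ, i, hi, rfl⟩
        · exact Or.inr ⟨κ, i, hi, rfl⟩
  · intro S
    rw [Finset.prod_mul_distrib, Finset.prod_comm]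
    refine mul_le_mul (le_of_eq ?_) (Finset.prod_le_prod (fun v _ => by positivity) fun v _ => ?_)
      (by positivity) (by positivity)
    · rw [Finset.prod_pow_eq_pow_sum]
      congr 1
      simp only [decide_eq_true_eq, Finset.card_filter]
      rw [Finset.sum_comm]
      refine Finset.sum_congr rfl fun u _ => ?_
      rw [← Finset.card_filter]
      have : (Finset.range k).filter (fun i => i < (S u).card) = Finset.range (S u).card := by
        have hk : (S u).card ≤ k := by simpa using Finset.card_le_univ (S u)
        ext i; simp; omega
      rw [this, Finset.card_range]
    · rw [Finset.prod_pow_eq_pow_sum, ← Finset.card_filter]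
      -- Over `v` the sorted layers block as many layers as the largest neighbouring fibre has, and
      -- the lifted neighbourhood contains an image of each of these fibres.
      refine pow_le_pow_of_le_one hp0.le hp1 ?_
      rw [← Finset.card_range (liftNbhd σ (τ v) S v).card]
      refine Finset.card_le_card fun i hi => ?_
      simp only [Finset.mem_filter, decide_eq_true_eq] at hi
      obtain ⟨-, κ, hκ⟩ := hi
      rw [Finset.mem_range]
      refine hκ.trans_le ?_
      rw [← Finset.card_map (τ v κ).toEmbedding]
      exact Finset.card_le_card (Finset.subset_biUnion_of_mem
        (fun κ => (S ((σ κ).symm v)).map (τ v κ).toEmbedding) (Finset.mem_univ κ))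

/-- Bethe-type lower bound for the partition function of an arbitrary union of perfect matchings,
by averaging over all lifts with `k` layers. -/
theorem pow_expectedCount_le (σ : Fin Δ → Equiv.Perm (Fin n)) {l₁ l₂ : ℝ} (h₁ : 0 < l₁)
    (h₂ : 0 < l₂) (k a b : ℕ) :
    (l₁ ^ a * l₂ ^ b * expectedCount Δ k a b) ^ n ≤ biPartition σ l₁ l₂ ^ k := by
  classical
  set N : ℝ := k.factorial * avoidProb k a b with hN
  set h : (Fin n → Finset (Fin k)) → Fin n → (Fin Δ → Equiv.Perm (Fin k)) → ℝ := fun S v t =>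
    ∑ T ∈ Finset.powersetCard b (Finset.univ : Finset (Fin k)),
      if ∀ κ, Disjoint T ((S ((σ κ).symm v)).map (t κ).toEmbedding) then l₂ ^ b else 0 with hh
  -- Only configurations with exactly `a` layers over each left vertex and `b` over each right
  -- vertex are kept.
  have hle : ∀ τ : Fin n → Fin Δ → Equiv.Perm (Fin k),
      ∑ S ∈ Fintype.piFinset
        (fun _ : Fin n => Finset.powersetCard a (Finset.univ : Finset (Fin k))),
        l₁ ^ (a * n) * ∏ v, h S v (τ v) ≤ biPartition σ l₁ l₂ ^ k := by
    intro τ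
    refine le_trans ?_ (sum_lift_le σ τ h₁ h₂)
    refine le_trans (Finset.sum_le_sum fun S hS => ?_)
      (Finset.sum_le_sum_of_subset_of_nonneg (Finset.subset_univ _) fun S _ _ => ?_)
    · have hS' : ∀ u, (S u).card = a := fun u =>
        (Finset.mem_powersetCard.1 (Fintype.mem_piFinset.1 hS u)).2
      have e : ∑ u, (S u).card = a * n := by simp [hS', mul_comm]
      rw [e]
      refine mul_le_mul_of_nonneg_left (Finset.prod_le_prod (fun v _ => ?_) fun v _ => ?_)
        (by positivity)
      · exact Finset.sum_nonneg fun T _ => by positivity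
      · refine le_trans (le_of_eq ?_)
          (Finset.sum_le_sum_of_subset_of_nonneg
            (Finset.subset_univ (Finset.powersetCard b Finset.univ)) fun T _ _ => ?_)
        · refine Finset.sum_congr rfl fun T hT => ?_
          rw [(Finset.mem_powersetCard.1 hT).2]
          exact if_congr disjoint_liftNbhd.symm rfl rfl
        · positivity
    · refine mul_nonneg (by positivity) (Finset.prod_nonneg fun v _ =>
        Finset.sum_nonneg fun T _ => by positivity)
  -- In the sum over all lifts the permutations at different pairs of a right vertex and a matching
  -- vary independently, so it factorizes.
  have hsum := Finset.sum_le_sum fun τ (_ : τ ∈ (Finset.univ :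
    Finset (Fin n → Fin Δ → Equiv.Perm (Fin k)))) => hle τ
  rw [Finset.sum_comm, Finset.sum_const, Finset.card_univ, nsmul_eq_mul] at hsum
  have hin : ∀ S ∈ Fintype.piFinset
      (fun _ : Fin n => Finset.powersetCard a (Finset.univ : Finset (Fin k))),
      ∑ τ : Fin n → Fin Δ → Equiv.Perm (Fin k), l₁ ^ (a * n) * ∏ v, h S v (τ v) =
        l₁ ^ (a * n) * (k.choose b * (l₂ ^ b * N ^ Δ)) ^ n := by
    intro S hS
    have hS' : ∀ u, (S u).card = a := fun u =>
      (Finset.mem_powersetCard.1 (Fintype.mem_piFinset.1 hS u)).2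
    rw [← Finset.mul_sum]
    congr 1
    have e1 := Finset.prod_univ_sum (fun _ : Fin n => (Finset.univ :
      Finset (Fin Δ → Equiv.Perm (Fin k)))) (fun v t => h S v t)
    rw [Fintype.piFinset_univ] at e1
    rw [← e1]
    have e2 : ∀ v, ∑ t : Fin Δ → Equiv.Perm (Fin k), h S v t = k.choose b * (l₂ ^ b * N ^ Δ) := by
      intro v
      simp only [hh]
      rw [Finset.sum_comm]
      have e3 : ∀ T ∈ Finset.powersetCard b (Finset.univ : Finset (Fin k)),
          (∑ t : Fin Δ → Equiv.Perm (Fin k),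
            if ∀ κ, Disjoint T ((S ((σ κ).symm v)).map (t κ).toEmbedding) then l₂ ^ b else 0) =
          l₂ ^ b * N ^ Δ := by
        intro T hT
        have e4 := Finset.prod_univ_sum (fun _ : Fin Δ => (Finset.univ :
          Finset (Equiv.Perm (Fin k)))) (fun κ π =>
            if Disjoint T ((S ((σ κ).symm v)).map π.toEmbedding) then (1 : ℝ) else 0)
        rw [Fintype.piFinset_univ] at e4
        have e5 : ∀ κ, (∑ π : Equiv.Perm (Fin k),
            if Disjoint T ((S ((σ κ).symm v)).map π.toEmbedding) then (1 : ℝ) else 0) = N := by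
          intro κ
          rw [Finset.sum_boole, card_perm_avoid, hS', (Finset.mem_powersetCard.1 hT).2]
        rw [Finset.prod_congr rfl (fun κ _ => e5 κ), Finset.prod_const, Finset.card_univ,
          Fintype.card_fin] at e4
        rw [e4, Finset.mul_sum]
        refine Finset.sum_congr rfl fun t _ => ?_
        rw [Finset.prod_ite_zero]
        simp
      rw [Finset.sum_congr rfl e3, Finset.sum_const, Finset.card_powersetCard, Finset.card_univ,
        Fintype.card_fin, nsmul_eq_mul]
    rw [Finset.prod_congr rfl (fun v _ => e2 v), Finset.prod_const, Finset.card_univ,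
      Fintype.card_fin]
  rw [Finset.sum_congr rfl hin, Finset.sum_const, Fintype.card_piFinset, nsmul_eq_mul] at hsum
  simp only [Finset.card_powersetCard, Finset.card_univ, Fintype.card_fin, Finset.prod_const,
    Fintype.card_fun, Fintype.card_perm] at hsum
  push_cast at hsum
  have hfac : (0 : ℝ) < ((k.factorial : ℝ) ^ Δ) ^ n := by positivity
  refine le_of_mul_le_mul_left (le_trans (le_of_eq ?_) hsum) hfac
  rw [expectedCount, hN, pow_mul, ← mul_pow, ← mul_pow, ← mul_pow]
  congr 1
  rw [mul_pow]
  ring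

end Lift

end HardCore

namespace HardCore

/-! ### Entropy bounds for binomial coefficients -/

/-- Cross-multiplied form of the fact that the term with exponents `a`, `b` is the largest in the
expansion of `(a + b) ^ (a + b)`. -/
lemma factorial_mul_pow_le_aux (a b j l : ℕ) (h : j + l = a + b) :
    a.factorial * b.factorial * (a ^ j * b ^ l) ≤ j.factorial * l.factorial * (a ^ a * b ^ b) := by
  have up : ∀ c d : ℕ, c.factorial * c ^ d ≤ (c + d).factorial := fun c d =>
    (Nat.mul_le_mul_left _ (Nat.pow_le_pow_left (Nat.le_succ c) d)).trans
      Nat.factorial_mul_pow_le_factorial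
  have down : ∀ c d : ℕ, (c + d).factorial ≤ c.factorial * (c + d) ^ d := by
    intro c d
    rw [← Nat.factorial_mul_descFactorial (Nat.le_add_left d c), Nat.add_sub_cancel]
    exact Nat.mul_le_mul_left _ (Nat.descFactorial_le_pow _ _)
  have key : ∀ a b j d : ℕ, a = j + d → a.factorial * b.factorial * (a ^ j * b ^ (b + d)) ≤
      j.factorial * (b + d).factorial * (a ^ a * b ^ b) := by
    rintro a b j d rfl
    calc (j + d).factorial * b.factorial * ((j + d) ^ j * b ^ (b + d))
        = (j + d).factorial * (b.factorial * b ^ d) * ((j + d) ^ j * b ^ b) := by ring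
      _ ≤ (j.factorial * (j + d) ^ d) * (b + d).factorial * ((j + d) ^ j * b ^ b) := by
          gcongr
          · exact down j d
          · exact up b d
      _ = _ := by ring
  rcases le_total j a with hj | hj
  · obtain ⟨d, rfl⟩ := Nat.exists_eq_add_of_le hj
    obtain rfl : l = b + d := by omega
    exact key _ b j d rfl
  · obtain ⟨d, rfl⟩ := Nat.exists_eq_add_of_le hj
    obtain rfl : b = l + d := by omega
    have := key (l + d) a l d rfl
    linarith

/-- The left side is one term of the binomial expansion of the right side. -/
lemma choose_mul_pow_le (a b : ℕ) : (a + b).choose a * (a ^ a * b ^ b) ≤ (a + b) ^ (a + b) := by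
  rw [add_pow a b (a + b)]
  have := Finset.single_le_sum (f := fun m => a ^ m * b ^ (a + b - m) * (a + b).choose m)
    (fun i _ => Nat.zero_le _) (Finset.mem_range.2 (show a < a + b + 1 by omega))
  refine le_trans (le_of_eq ?_) this
  simp only [Nat.add_sub_cancel_left]
  ring

/-- The expansion has `a + b + 1` terms, none larger than the one with exponents `a`, `b`. -/
lemma pow_le_choose_mul_pow (a b : ℕ) :
    (a + b) ^ (a + b) ≤ (a + b + 1) * ((a + b).choose a * (a ^ a * b ^ b)) := by
  rw [add_pow a b (a + b)]
  refine (Finset.sum_le_card_nsmul _ _ ((a + b).choose a * (a ^ a * b ^ b)) fun j hj => ?_).trans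
    (by simp)
  rw [Finset.mem_range] at hj
  obtain ⟨l, hl⟩ := Nat.exists_eq_add_of_le (Nat.lt_succ_iff.1 hj)
  have h1 := factorial_mul_pow_le_aux a b j l hl.symm
  have h2 : (a + b).choose j * j.factorial * l.factorial = (a + b).factorial := by
    have := Nat.choose_mul_factorial_mul_factorial (show j ≤ a + b by omega)
    rwa [show a + b - j = l by omega] at this
  have h3 : (a + b).choose a * a.factorial * b.factorial = (a + b).factorial := by
    have := Nat.choose_mul_factorial_mul_factorial (Nat.le_add_right a b)
    rwa [Nat.add_sub_cancel_left] at this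
  have e : a + b - j = l := by omega
  rw [e]
  have hpos : 0 < a.factorial * b.factorial * (j.factorial * l.factorial) := by positivity
  refine Nat.le_of_mul_le_mul_left ?_ hpos
  calc a.factorial * b.factorial * (j.factorial * l.factorial) *
        (a ^ j * b ^ l * (a + b).choose j)
      = (a.factorial * b.factorial * (a ^ j * b ^ l)) *
        ((a + b).choose j * j.factorial * l.factorial) := by ring
    _ ≤ (j.factorial * l.factorial * (a ^ a * b ^ b)) *
        ((a + b).choose j * j.factorial * l.factorial) := Nat.mul_le_mul_right _ h1
    _ = (j.factorial * l.factorial * (a ^ a * b ^ b)) *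
        ((a + b).choose a * a.factorial * b.factorial) := by rw [h2, h3]
    _ = _ := by ring

/-- `m log m`. -/
noncomputable def mulLog (m : ℕ) : ℝ := m * Real.log m

lemma exp_mulLog (m : ℕ) : Real.exp (mulLog m) = (m : ℝ) ^ m := by
  rcases Nat.eq_zero_or_pos m with rfl | h
  · simp [mulLog]
  · have : (0 : ℝ) < m := by exact_mod_cast h
    rw [mulLog, mul_comm, Real.exp_mul, Real.exp_log this, Real.rpow_natCast]

lemma choose_le_exp {n a : ℕ} (h : a ≤ n) :
    (n.choose a : ℝ) ≤ Real.exp (mulLog n - mulLog a - mulLog (n - a)) := by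
  obtain ⟨b, rfl⟩ := Nat.exists_eq_add_of_le h
  rw [Nat.add_sub_cancel_left, Real.exp_sub, Real.exp_sub, div_div, ← Real.exp_add,
    le_div_iff₀ (Real.exp_pos _), Real.exp_add, exp_mulLog, exp_mulLog, exp_mulLog]
  exact_mod_cast choose_mul_pow_le a b

lemma exp_le_choose {n a : ℕ} (h : a ≤ n) :
    Real.exp (mulLog n - mulLog a - mulLog (n - a)) ≤ (n + 1) * (n.choose a : ℝ) := by
  obtain ⟨b, rfl⟩ := Nat.exists_eq_add_of_le h
  rw [Nat.add_sub_cancel_left, Real.exp_sub, Real.exp_sub, div_div, ← Real.exp_add,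
    div_le_iff₀ (Real.exp_pos _), Real.exp_add, exp_mulLog, exp_mulLog, exp_mulLog, mul_assoc]
  exact_mod_cast pow_le_choose_mul_pow a b

/-! ### The Bethe entropy -/

/-- The exponential growth rate of the expected number of independent sets with densities `x` and
`y` on the two sides. -/
noncomputable def betheEntropy (Δ : ℕ) (x y : ℝ) : ℝ :=
  Real.negMulLog x + Real.negMulLog y -
    ((Δ : ℝ) - 1) * (Real.negMulLog (1 - x) + Real.negMulLog (1 - y)) +
    Δ * Real.negMulLog (1 - x - y)

lemma betheEntropy_comm (Δ : ℕ) (x y : ℝ) : betheEntropy Δ x y = betheEntropy Δ y x := by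
  rw [betheEntropy, betheEntropy, show 1 - x - y = 1 - y - x by ring]; ring

lemma continuous_betheEntropy (Δ : ℕ) : Continuous fun p : ℝ × ℝ => betheEntropy Δ p.1 p.2 := by
  unfold betheEntropy
  have := Real.continuous_negMulLog
  fun_prop

lemma mul_negMulLog_div {n m : ℕ} (hn : 0 < n) :
    (n : ℝ) * Real.negMulLog (m / n) = m * Real.log n - mulLog m := by
  have hn' : (n : ℝ) ≠ 0 := by exact_mod_cast hn.ne'
  rcases Nat.eq_zero_or_pos m with rfl | h
  · simp [mulLog]
  · have hm : (m : ℝ) ≠ 0 := by exact_mod_cast h.ne'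
    rw [Real.negMulLog, Real.log_div hm hn', mulLog]
    field_simp
    ring

/-- The grouping mirrors `expectedCount`: two binomial coefficients and `Δ` copies of the ratio in
`avoidProb`. -/
lemma mul_betheEntropy_div {Δ n a b : ℕ} (hn : 0 < n) (hab : a + b ≤ n) :
    (n : ℝ) * betheEntropy Δ (a / n) (b / n) =
      (mulLog n - mulLog a - mulLog (n - a)) + ((mulLog n - mulLog b - mulLog (n - b)) +
        Δ * ((mulLog (n - a) - mulLog b - mulLog (n - a - b)) -
          (mulLog n - mulLog b - mulLog (n - b)))) := by
  have hn' : (n : ℝ) ≠ 0 := by exact_mod_cast hn.ne'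
  have e1 : 1 - (a : ℝ) / n = ((n - a : ℕ) : ℝ) / n := by
    rw [Nat.cast_sub (by omega)]; field_simp
  have e2 : 1 - (b : ℝ) / n = ((n - b : ℕ) : ℝ) / n := by
    rw [Nat.cast_sub (by omega)]; field_simp
  have e3 : ((n - a : ℕ) : ℝ) / n - (b : ℝ) / n = ((n - a - b : ℕ) : ℝ) / n := by
    rw [Nat.cast_sub (show b ≤ n - a by omega)]; field_simp
  have h1 := mul_negMulLog_div (m := a) hn
  have h2 := mul_negMulLog_div (m := b) hn
  have h3 := mul_negMulLog_div (m := n - a) hn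
  have h4 := mul_negMulLog_div (m := n - b) hn
  have h5 := mul_negMulLog_div (m := n - a - b) hn
  rw [Nat.cast_sub (show b ≤ n - a by omega), Nat.cast_sub (show a ≤ n by omega),
    ← Nat.cast_sub (show a ≤ n by omega), ← Nat.cast_sub (show b ≤ n - a by omega)] at h5
  rw [betheEntropy, e1, e2, e3]
  have c3 : ((n - a : ℕ) : ℝ) = n - a := Nat.cast_sub (by omega)
  have c4 : ((n - b : ℕ) : ℝ) = n - b := Nat.cast_sub (by omega)
  have c5 : ((n - a - b : ℕ) : ℝ) = n - a - b := by
    rw [Nat.cast_sub (show b ≤ n - a by omega), c3]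
  have h6 : mulLog n = n * Real.log n := rfl
  linear_combination h1 + h2 - ((Δ : ℝ) - 1) * (h3 + h4) + Δ * h5 +
    (-((Δ : ℝ) - 1) * Real.log n) * (c3 + c4) + (Δ * Real.log n) * c5 + ((Δ : ℝ) - 2) * h6

/-- Only the denominators of `avoidProb` lose a factor `n + 1`, once per matching. -/
lemma expectedCount_le {Δ n a b : ℕ} (hn : 0 < n) (hab : a + b ≤ n) :
    expectedCount Δ n a b ≤ (n + 1) ^ Δ * Real.exp (n * betheEntropy Δ (a / n) (b / n)) := by
  have h1 := choose_le_exp (show a ≤ n by omega)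
  have h2 := choose_le_exp (show b ≤ n by omega)
  have h2' := exp_le_choose (show b ≤ n by omega)
  have h3 := choose_le_exp (show b ≤ n - a by omega)
  have hC : (0 : ℝ) < n.choose b := by exact_mod_cast Nat.choose_pos (show b ≤ n by omega)
  rw [mul_betheEntropy_div hn hab, Real.exp_add, Real.exp_add, Real.exp_nat_mul,
    Real.exp_sub (mulLog (n - a) - mulLog b - mulLog (n - a - b)), mul_left_comm,
    mul_left_comm ((n + 1 : ℝ) ^ Δ), ← mul_pow, expectedCount]
  have hp : 0 ≤ avoidProb n a b := by unfold avoidProb; positivity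
  have hq : avoidProb n a b ≤ (n + 1) *
      (Real.exp (mulLog (n - a) - mulLog b - mulLog (n - a - b)) /
        Real.exp (mulLog n - mulLog b - mulLog (n - b))) := by
    rw [avoidProb, mul_div_assoc', div_le_div_iff₀ hC (Real.exp_pos _)]
    calc _ ≤ Real.exp (mulLog (n - a) - mulLog b - mulLog (n - a - b)) *
          ((n + 1) * (n.choose b : ℝ)) := by gcongr
      _ = _ := by ring
  gcongr

/-- Here the numerators lose the factors: one per matching and two for the outer binomial
coefficients. -/
lemma exp_le_expectedCount {Δ n a b : ℕ} (hn : 0 < n) (hab : a + b ≤ n) :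
    Real.exp (n * betheEntropy Δ (a / n) (b / n)) ≤ (n + 1) ^ (Δ + 2) * expectedCount Δ n a b := by
  have h1 := exp_le_choose (show a ≤ n by omega)
  have h2 := exp_le_choose (show b ≤ n by omega)
  have h2' := choose_le_exp (show b ≤ n by omega)
  have h3 := exp_le_choose (show b ≤ n - a by omega)
  have hC : (0 : ℝ) < n.choose b := by exact_mod_cast Nat.choose_pos (show b ≤ n by omega)
  have e : (n + 1 : ℝ) ^ (Δ + 2) * expectedCount Δ n a b = ((n + 1) * (n.choose a : ℝ)) *
      (((n + 1) * (n.choose b : ℝ)) * ((n + 1) * avoidProb n a b) ^ Δ) := by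
    rw [expectedCount, mul_pow]; ring
  rw [mul_betheEntropy_div hn hab, Real.exp_add, Real.exp_add, Real.exp_nat_mul,
    Real.exp_sub (mulLog (n - a) - mulLog b - mulLog (n - a - b)), e]
  gcongr
  rw [avoidProb, mul_div_assoc', div_le_div_iff₀ (Real.exp_pos _) hC]
  have h4 : ((n - a : ℕ) : ℝ) ≤ n := by exact_mod_cast Nat.sub_le n a
  calc _ ≤ (((n - a : ℕ) + 1) * ((n - a).choose b : ℝ)) *
        Real.exp (mulLog n - mulLog b - mulLog (n - b)) := by gcongr
    _ ≤ _ := by gcongr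

/-! ### Bethe lower bound for an arbitrary union of matchings -/

lemma biPartition_pos {n Δ : ℕ} (σ : Fin Δ → Equiv.Perm (Fin n)) {l₁ l₂ : ℝ} (h₁ : 0 < l₁)
    (h₂ : 0 < l₂) : 0 < biPartition σ l₁ l₂ := by
  rw [biPartition_eq σ l₁ l₂ h₂]
  exact mul_pos (by positivity) (Finset.sum_pos (fun x _ => by positivity) Finset.univ_nonempty)

/-- The Bethe lower bound, valid for every union of perfect matchings. -/
theorem exp_bethe_le_biPartition {n Δ : ℕ} (σ : Fin Δ → Equiv.Perm (Fin n)) {l₁ l₂ : ℝ}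
    (h₁ : 0 < l₁) (h₂ : 0 < l₂) {x y : ℝ} (hx : 0 ≤ x) (hy : 0 ≤ y) (hxy : x + y ≤ 1) :
    Real.exp (n * (betheEntropy Δ x y + x * Real.log l₁ + y * Real.log l₂)) ≤
      biPartition σ l₁ l₂ := by
  have hZ := biPartition_pos σ h₁ h₂
  rw [← Real.le_log_iff_exp_le hZ]
  -- The number of layers `k` tends to infinity at densities converging to `x` and `y`; the
  -- polynomial loss becomes a multiple of `log (k + 1) / k`.
  set u : ℕ → ℝ := fun k => (⌊x * k⌋₊ : ℝ) / k
  set v : ℕ → ℝ := fun k => (⌊y * k⌋₊ : ℝ) / k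
  have hu : Filter.Tendsto u Filter.atTop (nhds x) :=
    (tendsto_nat_floor_mul_div_atTop hx).comp tendsto_natCast_atTop_atTop
  have hv : Filter.Tendsto v Filter.atTop (nhds y) :=
    (tendsto_nat_floor_mul_div_atTop hy).comp tendsto_natCast_atTop_atTop
  have hlog : Filter.Tendsto (fun k : ℕ => Real.log ((k : ℝ) + 1) / k) Filter.atTop (nhds 0) := by
    have h1 : Filter.Tendsto (fun k : ℕ => Real.log ((k : ℝ) + 1) / ((k : ℝ) + 1))
        Filter.atTop (nhds 0) := by
      have := Real.isLittleO_log_id_atTop.tendsto_div_nhds_zero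
      exact this.comp (Filter.tendsto_atTop_add_const_right _ 1 tendsto_natCast_atTop_atTop)
    have h2 : Filter.Tendsto (fun k : ℕ => 1 + 1 / (k : ℝ)) Filter.atTop (nhds (1 + 0)) :=
      tendsto_const_nhds.add tendsto_one_div_atTop_nhds_zero_nat
    have h3 := h1.mul h2
    rw [zero_mul] at h3
    refine h3.congr' ?_
    filter_upwards [Filter.eventually_gt_atTop 0] with k hk
    have : (0 : ℝ) < k := by exact_mod_cast hk
    field_simp
  have hlim : Filter.Tendsto (fun k : ℕ => (n : ℝ) * ((betheEntropy Δ (u k) (v k) +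
      u k * Real.log l₁ + v k * Real.log l₂) -
      ((Δ + 2 : ℕ) : ℝ) * (Real.log ((k : ℝ) + 1) / k))) Filter.atTop
      (nhds (n * ((betheEntropy Δ x y + x * Real.log l₁ + y * Real.log l₂) -
        ((Δ + 2 : ℕ) : ℝ) * 0))) := by
    refine Filter.Tendsto.const_mul _ (Filter.Tendsto.sub ?_ (hlog.const_mul _))
    refine Filter.Tendsto.add (Filter.Tendsto.add ?_ (hu.mul_const _)) (hv.mul_const _)
    have h1 := ((continuous_betheEntropy Δ).tendsto (x, y)).comp (hu.prodMk_nhds hv)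
    exact h1
  rw [mul_zero, sub_zero] at hlim
  refine le_of_tendsto hlim ?_
  filter_upwards [Filter.eventually_gt_atTop 0] with k hk
  have hk' : (0 : ℝ) < k := by exact_mod_cast hk
  set a := ⌊x * k⌋₊
  set b := ⌊y * k⌋₊
  have hab : a + b ≤ k := by
    have h1 : (a : ℝ) ≤ x * k := Nat.floor_le (by positivity)
    have h2 : (b : ℝ) ≤ y * k := Nat.floor_le (by positivity)
    have : ((a + b : ℕ) : ℝ) ≤ k := by push_cast; nlinarith
    exact_mod_cast this
  have h3 := pow_expectedCount_le σ h₁ h₂ k a b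
  have h4 := exp_le_expectedCount (Δ := Δ) hk hab
  have hF : 0 < expectedCount Δ k a b := by
    have := (Real.exp_pos _).trans_le h4
    exact pos_of_mul_pos_right this (by positivity)
  have h5 := Real.log_le_log (by positivity) h3
  rw [Real.log_pow, Real.log_pow, Real.log_mul (by positivity) hF.ne',
    Real.log_mul (by positivity) (by positivity), Real.log_pow, Real.log_pow] at h5
  have h6 := Real.log_le_log (Real.exp_pos _) h4
  rw [Real.log_exp, Real.log_mul (by positivity) hF.ne', Real.log_pow] at h6
  have h7 : (n : ℝ) * (k * betheEntropy Δ (u k) (v k)) ≤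
      n * (((Δ + 2 : ℕ) : ℝ) * Real.log ((k : ℝ) + 1) + Real.log (expectedCount Δ k a b)) :=
    mul_le_mul_of_nonneg_left h6 (Nat.cast_nonneg n)
  refine le_of_mul_le_mul_left ?_ hk'
  refine le_trans ?_ h5
  have e1 : (k : ℝ) * u k = a := mul_div_cancel₀ _ hk'.ne'
  have e2 : (k : ℝ) * v k = b := mul_div_cancel₀ _ hk'.ne'
  have e3 : (k : ℝ) * (Real.log ((k : ℝ) + 1) / k) = Real.log ((k : ℝ) + 1) := by field_simp
  calc _ = n * (k * betheEntropy Δ (u k) (v k)) + n * ((k * u k) * Real.log l₁) +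
        n * ((k * v k) * Real.log l₂) -
        n * (((Δ + 2 : ℕ) : ℝ) * (k * (Real.log ((k : ℝ) + 1) / k))) := by ring
    _ ≤ _ := by rw [e1, e2, e3]; linarith

/-! ### Symmetry breaking above the critical activity -/

/-- The densities which are possible for an independent set. -/
def densityTriangle : Set (ℝ × ℝ) := {p | 0 ≤ p.1 ∧ 0 ≤ p.2 ∧ p.1 + p.2 ≤ 1}

lemma isCompact_densityTriangle : IsCompact densityTriangle := by
  refine (isCompact_Icc (a := ((0, 0) : ℝ × ℝ)) (b := (1, 1))).of_isClosed_subset ?_ ?_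
  · exact (isClosed_le continuous_const continuous_fst).inter
      ((isClosed_le continuous_const continuous_snd).inter
        (isClosed_le (continuous_fst.add continuous_snd) continuous_const))
  · rintro ⟨x, y⟩ ⟨h1, h2, h3⟩
    simp only at h1 h2 h3
    exact ⟨⟨h1, h2⟩, ⟨by simp only; linarith, by simp only; linarith⟩⟩

/-- The Bethe free energy at logarithmic activity `l`. -/
noncomputable def betheEnergy (Δ : ℕ) (l : ℝ) (p : ℝ × ℝ) : ℝ :=
  betheEntropy Δ p.1 p.2 + l * (p.1 + p.2)

lemma continuous_betheEnergy (Δ : ℕ) (l : ℝ) : Continuous (betheEnergy Δ l) := by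
  unfold betheEnergy
  have := continuous_betheEntropy Δ
  fun_prop

lemma betheEnergy_swap (Δ : ℕ) (l : ℝ) (p : ℝ × ℝ) :
    betheEnergy Δ l p.swap = betheEnergy Δ l p := by
  simp only [betheEnergy, Prod.fst_swap, Prod.snd_swap]
  rw [betheEntropy_comm, add_comm p.2]

lemma hasDerivAt_negMulLog_comp {f : ℝ → ℝ} {f' x : ℝ} (hf : HasDerivAt f f' x) (h : f x ≠ 0) :
    HasDerivAt (fun t => Real.negMulLog (f t)) ((-Real.log (f x) - 1) * f') x :=
  HasDerivAt.comp x (Real.hasDerivAt_negMulLog h) hf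

lemma hasDerivAt_diagonal (Δ : ℕ) (l : ℝ) {x : ℝ} (h0 : 0 < x) (h1 : x < 1 / 2) :
    HasDerivAt (fun t => betheEnergy Δ l (t, t))
      (2 * (l - Real.log x - ((Δ : ℝ) - 1) * Real.log (1 - x) + Δ * Real.log (1 - x - x))) x := by
  have d1 := Real.hasDerivAt_negMulLog h0.ne'
  have i2 : HasDerivAt (fun t : ℝ => 1 - t) (-1) x := (hasDerivAt_id x).const_sub 1
  have i3 : HasDerivAt (fun t : ℝ => 1 - t - t) (-1 - 1) x := i2.sub (hasDerivAt_id x)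
  have d2 := hasDerivAt_negMulLog_comp i2 (by linarith)
  have d3 := hasDerivAt_negMulLog_comp i3 (by linarith)
  have d4 : HasDerivAt (fun t : ℝ => l * (t + t)) _ x :=
    ((hasDerivAt_id x).add (hasDerivAt_id x)).const_mul l
  have := (((d1.add d1).sub ((d2.add d2).const_mul ((Δ : ℝ) - 1))).add
    (d3.const_mul (Δ : ℝ))).add d4
  refine this.congr_deriv ?_
  ring

lemma criticalActivity_pos {Δ : ℕ} (hΔ : 3 ≤ Δ) : 0 < criticalActivity Δ := by
  have hΔ' : (3 : ℝ) ≤ Δ := by exact_mod_cast hΔ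
  have h2 : (0 : ℝ) < (Δ : ℝ) - 1 := by linarith
  have h3 : (0 : ℝ) < (Δ : ℝ) - 2 := by linarith
  rw [criticalActivity]; positivity

/-- The expression vanishes at the critical activity and `x = 1 / Δ`. The two logarithmic
inequalities in the proof are each equivalent to `x * Δ ≤ 1`. -/
lemma diagonal_deriv_pos {Δ : ℕ} (hΔ : 3 ≤ Δ) {lam : ℝ} (hlam : criticalActivity Δ < lam) {x : ℝ}
    (h0 : 0 < x) (h1 : x * Δ ≤ 1) :
    0 < Real.log lam - Real.log x - ((Δ : ℝ) - 1) * Real.log (1 - x) +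
      Δ * Real.log (1 - x - x) := by
  have hΔ' : (3 : ℝ) ≤ Δ := by exact_mod_cast hΔ
  have hx : x ≤ 1 / 3 := by nlinarith
  have hcrit : Real.log (criticalActivity Δ) =
      ((Δ : ℝ) - 1) * Real.log ((Δ : ℝ) - 1) - Δ * Real.log ((Δ : ℝ) - 2) := by
    have h2 : (0 : ℝ) < (Δ : ℝ) - 1 := by linarith
    have h3 : (0 : ℝ) < (Δ : ℝ) - 2 := by linarith
    rw [criticalActivity, Real.log_div (by positivity) (by positivity), Real.log_pow, Real.log_pow,
      Nat.cast_sub (by omega), Nat.cast_one]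
  have hl := Real.log_lt_log (criticalActivity_pos hΔ) hlam
  rw [hcrit] at hl
  have a1 : Real.log x + Real.log ((Δ : ℝ) - 2) ≤ Real.log (1 - x - x) := by
    rw [← Real.log_mul h0.ne' (by linarith)]
    exact Real.log_le_log (mul_pos h0 (by linarith)) (by nlinarith)
  have a2 : Real.log (1 - x) + Real.log ((Δ : ℝ) - 2) ≤
      Real.log (1 - x - x) + Real.log ((Δ : ℝ) - 1) := by
    rw [← Real.log_mul (by linarith) (by linarith), ← Real.log_mul (by linarith) (by linarith)]
    exact Real.log_le_log (mul_pos (by linarith) (by linarith)) (by nlinarith)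
  nlinarith [mul_le_mul_of_nonneg_left a2 (show (0 : ℝ) ≤ (Δ : ℝ) - 1 by linarith)]

/-- Above the critical activity no point of the diagonal maximizes the Bethe free energy. -/
theorem exists_lt_betheEnergy {Δ : ℕ} (hΔ : 3 ≤ Δ) {lam : ℝ} (hlam : criticalActivity Δ < lam)
    {x : ℝ} (hx0 : 0 ≤ x) (hx1 : x ≤ 1 / 2) :
    ∃ p ∈ densityTriangle,
      betheEnergy Δ (Real.log lam) (x, x) < betheEnergy Δ (Real.log lam) p := by
  have hΔ' : (3 : ℝ) ≤ Δ := by exact_mod_cast hΔ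
  have hΔinv : 1 / (Δ : ℝ) ≤ 1 / 3 := one_div_le_one_div_of_le (by norm_num) hΔ'
  have hΔpos : 0 < 1 / (Δ : ℝ) := by positivity
  by_contra! hmax
  set φ : ℝ → ℝ := fun t => betheEnergy Δ (Real.log lam) (t, t) with hφ
  have hφc : Continuous φ := (continuous_betheEnergy _ _).comp (by fun_prop)
  have hdiag : ∀ t, 0 ≤ t → t ≤ 1 / 2 → φ t ≤ φ x := fun t h0 h1 =>
    hmax (t, t) ⟨h0, h0, by simp only; linarith⟩
  have hxΔ : 1 / (Δ : ℝ) < x := by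
    by_contra! hle
    rcases hx0.eq_or_lt with h0 | h0
    · have hmono : StrictMonoOn φ (Set.Icc 0 (1 / (Δ : ℝ))) := by
        refine strictMonoOn_of_deriv_pos (convex_Icc _ _) hφc.continuousOn fun t ht => ?_
        rw [interior_Icc] at ht
        rw [(hasDerivAt_diagonal Δ _ ht.1 (by linarith [ht.2])).deriv]
        have := diagonal_deriv_pos hΔ hlam ht.1 (by
          have := ht.2.le; rw [le_div_iff₀ (by linarith)] at this; exact this)
        linarith
      have := hmono (Set.left_mem_Icc.2 hΔpos.le) (Set.right_mem_Icc.2 hΔpos.le) hΔpos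
      have h2 := hdiag _ hΔpos.le (by linarith)
      rw [← h0] at h2
      linarith
    · have hd := hasDerivAt_diagonal Δ (Real.log lam) h0 (by linarith)
      have hloc : IsLocalMax φ x := by
        filter_upwards [Ioo_mem_nhds h0 (show x < 1 / 2 by linarith)] with t ht
        exact hdiag t ht.1.le ht.2.le
      have h3 := hloc.hasDerivAt_eq_zero hd
      have h4 := diagonal_deriv_pos hΔ hlam h0 (by
        rw [le_div_iff₀ (by linarith)] at hle; exact hle)
      linarith
  have hx : 0 < x := hΔpos.trans hxΔ
  -- Moving transversally keeps `x + y` fixed, so the term in `1 - x - y` is constant and `x = 1 /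
  -- 2` causes no trouble.
  set ψ : ℝ → ℝ := fun t => betheEnergy Δ (Real.log lam) (x + t, x - t) with hψ
  set g : ℝ → ℝ := fun t => Real.log (x - t) - Real.log (x + t) +
    ((Δ : ℝ) - 1) * (Real.log (1 - x + t) - Real.log (1 - x - t)) with hg
  have hψd : ∀ t, |t| < x → HasDerivAt ψ (g t) t := by
    intro t ht
    rw [abs_lt] at ht
    have i1 : HasDerivAt (fun t : ℝ => x + t) 1 t := (hasDerivAt_id t).const_add x
    have i2 : HasDerivAt (fun t : ℝ => x - t) (-1) t := (hasDerivAt_id t).const_sub x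
    have d1 : HasDerivAt (fun t : ℝ => Real.negMulLog (x + t)) _ t :=
      hasDerivAt_negMulLog_comp i1 (by linarith)
    have d2 : HasDerivAt (fun t : ℝ => Real.negMulLog (x - t)) _ t :=
      hasDerivAt_negMulLog_comp i2 (by linarith)
    have d3 : HasDerivAt (fun t : ℝ => Real.negMulLog (1 - (x + t))) _ t :=
      hasDerivAt_negMulLog_comp (i1.const_sub 1) (by linarith)
    have d4 : HasDerivAt (fun t : ℝ => Real.negMulLog (1 - (x - t))) _ t :=
      hasDerivAt_negMulLog_comp (i2.const_sub 1) (by linarith)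
    have h5 : ψ = fun t => Real.negMulLog (x + t) + Real.negMulLog (x - t) -
        ((Δ : ℝ) - 1) * (Real.negMulLog (1 - (x + t)) + Real.negMulLog (1 - (x - t))) +
        (Δ * Real.negMulLog (1 - x - x) + Real.log lam * (x + x)) := by
      funext t
      simp only [hψ, betheEnergy, betheEntropy]
      rw [show 1 - (x + t) - (x - t) = 1 - x - x by ring]
      ring
    rw [h5]
    refine (((d1.add d2).sub ((d3.add d4).const_mul ((Δ : ℝ) - 1))).add_const _).congr_deriv ?_
    simp only [hg]
    rw [show 1 - (x + t) = 1 - x - t by ring, show 1 - (x - t) = 1 - x + t by ring]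
    ring
  have hgd : HasDerivAt g (2 * (((Δ : ℝ) - 1) / (1 - x) - 1 / x)) 0 := by
    have k1 : HasDerivAt (fun t : ℝ => Real.log (x - t)) _ 0 :=
      ((hasDerivAt_id (0 : ℝ)).const_sub x).log (by simp; linarith)
    have k2 : HasDerivAt (fun t : ℝ => Real.log (x + t)) _ 0 :=
      ((hasDerivAt_id (0 : ℝ)).const_add x).log (by simp; linarith)
    have k3 : HasDerivAt (fun t : ℝ => Real.log (1 - x + t)) _ 0 :=
      ((hasDerivAt_id (0 : ℝ)).const_add (1 - x)).log (by simp; linarith)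
    have k4 : HasDerivAt (fun t : ℝ => Real.log (1 - x - t)) _ 0 :=
      ((hasDerivAt_id (0 : ℝ)).const_sub (1 - x)).log (by simp; linarith)
    refine ((k1.sub k2).add ((k3.sub k4).const_mul ((Δ : ℝ) - 1))).congr_deriv ?_
    simp only [id_eq, add_zero, sub_zero]
    ring
  have hnear : ∀ᶠ t : ℝ in nhds 0, |t| < x := by
    have : Filter.Tendsto (fun t : ℝ => |t|) (nhds 0) (nhds |(0 : ℝ)|) := continuous_abs.tendsto 0
    rw [abs_zero] at this
    exact this.eventually_lt_const hx
  have hderiv : deriv ψ =ᶠ[nhds 0] g := by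
    filter_upwards [hnear] with t ht using (hψd t ht).deriv
  have hpos : 0 < 2 * (((Δ : ℝ) - 1) / (1 - x) - 1 / x) := by
    have : 1 / x < ((Δ : ℝ) - 1) / (1 - x) := by
      rw [div_lt_div_iff₀ hx (by linarith)]
      rw [div_lt_iff₀ (by linarith)] at hxΔ
      nlinarith
    linarith
  -- A positive second derivative gives a local minimum; as `0` is also a maximum, `ψ` is locally
  -- constant, which forces that second derivative to vanish.
  have hmin : IsLocalMin ψ 0 := by
    refine isLocalMin_of_deriv_deriv_pos ?_ ?_ ?_
    · rw [hderiv.deriv_eq, hgd.deriv]; exact hpos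
    · rw [(hψd 0 (by simpa using hx)).deriv]; simp [hg]
    · exact (hψd 0 (by simpa using hx)).continuousAt
  have hconst : ψ =ᶠ[nhds 0] fun _ => ψ 0 := by
    filter_upwards [hmin, hnear] with t h1 h2
    rw [abs_lt] at h2
    refine le_antisymm ?_ h1
    have := hmax (x + t, x - t) ⟨by simp only; linarith, by simp only; linarith,
      by simp only; linarith⟩
    simpa [hψ] using this
  have hzero : g =ᶠ[nhds 0] fun _ => 0 := by
    have := hconst.deriv
    filter_upwards [this, hderiv] with t h1 h2
    rw [← h2, h1, deriv_const]
  have := hzero.deriv_eq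
  rw [hgd.deriv, deriv_const] at this
  linarith

/-- The hypothesis makes `max u v` positive on `K`; half of its minimum serves as `c`. -/
lemma exists_gap {X : Type*} [TopologicalSpace X] {K : Set X} (hK : IsCompact K) {u v : X → ℝ}
    (hu : Continuous u) (hv : Continuous v) (h : ∀ p ∈ K, v p ≤ 0 → 0 < u p) :
    ∃ c > 0, ∀ p ∈ K, v p ≤ c → c ≤ u p := by
  rcases K.eq_empty_or_nonempty with rfl | hne
  · exact ⟨1, one_pos, by simp⟩
  obtain ⟨q, hq, hmin⟩ := hK.exists_isMinOn hne (hu.max hv).continuousOn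
  have hpos : 0 < max (u q) (v q) := by
    rcases le_or_gt (v q) 0 with h1 | h1
    · exact lt_max_of_lt_left (h q hq h1)
    · exact lt_max_of_lt_right h1
  refine ⟨max (u q) (v q) / 2, by linarith, fun p hp hvp => ?_⟩
  have h2 : max (u q) (v q) ≤ max (u p) (v p) := hmin hp
  rcases le_max_iff.1 h2 with h3 | h3 <;> linarith

/-- With a small field in favour of the left side, left-biased densities dominate. -/
theorem exists_field {Δ : ℕ} (hΔ : 3 ≤ Δ) {lam : ℝ} (hlam : criticalActivity Δ < lam) :
    ∃ s > 0, ∃ δ > 0, ∃ η > 0, ∃ q ∈ densityTriangle,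
      (∀ p ∈ densityTriangle, p.1 ≤ p.2 + δ → betheEnergy Δ (Real.log lam) p + s * p.1 ≤
        betheEnergy Δ (Real.log lam) q + s * q.1 - η) ∧
      (∀ p ∈ densityTriangle, |p.1 - p.2| ≤ δ → betheEnergy Δ (Real.log lam) p ≤
        betheEnergy Δ (Real.log lam) q + s * q.1 - s - η) := by
  set E := betheEnergy Δ (Real.log lam) with hE
  have hEc : Continuous E := continuous_betheEnergy _ _
  have hne : densityTriangle.Nonempty := ⟨(0, 0), by simp [densityTriangle]⟩
  obtain ⟨q₀, hq₀, hmax₀⟩ := isCompact_densityTriangle.exists_isMaxOn hne hEc.continuousOn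
  obtain ⟨x₀, hx₀, hdiag⟩ := (isCompact_Icc (a := (0 : ℝ)) (b := 1 / 2)).exists_isMaxOn
    ⟨0, by norm_num⟩ (hEc.comp (show Continuous fun t : ℝ => (t, t) by fun_prop)).continuousOn
  have hgap : E (x₀, x₀) < E q₀ := by
    obtain ⟨p, hp, hlt⟩ := exists_lt_betheEnergy hΔ hlam hx₀.1 hx₀.2
    exact hlt.trans_le (hmax₀ hp)
  -- Half of the gap: the diagonal lies `2 * s` below `E q₀`, hence strictly below it even after `s`
  -- is spent on the field.
  set s := (E q₀ - E (x₀, x₀)) / 2 with hs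
  have hspos : 0 < s := by rw [hs]; linarith
  obtain ⟨q, hq, hmax⟩ := isCompact_densityTriangle.exists_isMaxOn hne
    (hEc.add
      (continuous_const.mul continuous_fst : Continuous fun p : ℝ × ℝ => s * p.1)).continuousOn
  have hqmax : ∀ p ∈ densityTriangle, E p + s * p.1 ≤ E q + s * q.1 := fun p hp => hmax hp
  have hq0 : E q₀ ≤ E q + s * q.1 := by
    have := hqmax q₀ hq₀
    have h1 : 0 ≤ s * q₀.1 := mul_nonneg hspos.le hq₀.1
    linarith
  have hd : ∀ p ∈ densityTriangle, p.1 = p.2 → E p ≤ E (x₀, x₀) := by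
    rintro ⟨x, y⟩ ⟨h1, h2, h3⟩ h4
    simp only at h1 h2 h3 h4
    subst h4
    exact hdiag (show x ∈ Set.Icc (0 : ℝ) (1 / 2) from ⟨h1, by linarith⟩)
  obtain ⟨c₁, hc₁, hgap₁⟩ := exists_gap isCompact_densityTriangle
    (u := fun p => E q + s * q.1 - (E p + s * p.1)) (v := fun p => p.1 - p.2)
    (by fun_prop) (by fun_prop) (by
      intro p hp hle
      rcases (sub_nonpos.1 hle).eq_or_lt with h1 | h1
      · have h2 := hd p hp h1
        have h3 : p.1 ≤ 1 := by linarith [hp.2.1, hp.2.2]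
        nlinarith
      · have h2 := hqmax p.swap ⟨hp.2.1, hp.1, by
          simp only [Prod.fst_swap, Prod.snd_swap]; linarith [hp.2.2]⟩
        rw [hE, betheEnergy_swap, ← hE, Prod.fst_swap] at h2
        nlinarith)
  obtain ⟨c₂, hc₂, hgap₂⟩ := exists_gap isCompact_densityTriangle
    (u := fun p => E q + s * q.1 - s - E p) (v := fun p => |p.1 - p.2|)
    (by fun_prop) (by fun_prop) (by
      intro p hp hle
      have h1 : p.1 = p.2 := sub_eq_zero.1 (abs_nonpos_iff.1 hle)
      have h2 := hd p hp h1
      linarith)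
  refine ⟨s, hspos, min c₁ c₂, lt_min hc₁ hc₂, min c₁ c₂, lt_min hc₁ hc₂, q, hq, ?_, ?_⟩
  · intro p hp h1
    have := hgap₁ p hp (by linarith [min_le_left c₁ c₂])
    linarith [min_le_left c₁ c₂]
  · intro p hp h1
    have := hgap₂ p hp (h1.trans (min_le_right _ _))
    linarith [min_le_right c₁ c₂]

end HardCore

namespace HardCore

/-! ### Independent sets of a union of matchings as pairs -/

section Pairs

variable {n Δ : ℕ}

lemma isIndepSet_unionOfMatchings_iff (σ : Fin Δ → Equiv.Perm (Fin n))
    (X : Finset (Fin n ⊕ Fin n)) :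
    (unionOfMatchings σ).IsIndepSet (X : Set (Fin n ⊕ Fin n)) ↔ Compat σ X.toLeft X.toRight := by
  constructor
  · intro h κ
    rw [Finset.disjoint_left]
    intro j hj hj'
    obtain ⟨i, hi, rfl⟩ := Finset.mem_map.1 hj'
    rw [Finset.mem_toLeft] at hi
    rw [Finset.mem_toRight] at hj
    exact h hi hj (by simp) ⟨κ, i, Or.inl ⟨rfl, rfl⟩⟩
  · rintro h x hx y hy - ⟨κ, i, ⟨rfl, rfl⟩ | ⟨rfl, rfl⟩⟩
    · exact Finset.disjoint_left.1 (h κ) (Finset.mem_toRight.2 hy)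
        (Finset.mem_map.2 ⟨i, Finset.mem_toLeft.2 hx, rfl⟩)
    · exact Finset.disjoint_left.1 (h κ) (Finset.mem_toRight.2 hx)
        (Finset.mem_map.2 ⟨i, Finset.mem_toLeft.2 hy, rfl⟩)

/-- The total weight of the independent sets, for a weight depending on the numbers of vertices on
the two sides. -/
noncomputable def pairSum (σ : Fin Δ → Equiv.Perm (Fin n)) (w : ℕ → ℕ → ℝ) : ℝ :=
  ∑ A : Finset (Fin n), ∑ B : Finset (Fin n), if Compat σ A B then w A.card B.card else 0

lemma pairSum_add (σ : Fin Δ → Equiv.Perm (Fin n)) (w w' : ℕ → ℕ → ℝ) :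
    pairSum σ (fun a b => w a b + w' a b) = pairSum σ w + pairSum σ w' := by
  simp only [pairSum, ← Finset.sum_add_distrib]
  refine Finset.sum_congr rfl fun A _ => Finset.sum_congr rfl fun B _ => ?_
  split_ifs <;> simp

lemma pairSum_const_mul (σ : Fin Δ → Equiv.Perm (Fin n)) (c : ℝ) (w : ℕ → ℕ → ℝ) :
    pairSum σ (fun a b => c * w a b) = c * pairSum σ w := by
  simp only [pairSum, Finset.mul_sum]
  refine Finset.sum_congr rfl fun A _ => Finset.sum_congr rfl fun B _ => ?_
  split_ifs <;> simp

lemma pairSum_le_pairSum (σ : Fin Δ → Equiv.Perm (Fin n)) {w w' : ℕ → ℕ → ℝ}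
    (h : ∀ a ≤ n, ∀ b ≤ n, w a b ≤ w' a b) : pairSum σ w ≤ pairSum σ w' := by
  refine Finset.sum_le_sum fun A _ => Finset.sum_le_sum fun B _ => ?_
  have hA : A.card ≤ n := by simpa using Finset.card_le_univ A
  have hB : B.card ≤ n := by simpa using Finset.card_le_univ B
  split_ifs
  · exact h _ hA _ hB
  · exact le_rfl

lemma pairSum_nonneg (σ : Fin Δ → Equiv.Perm (Fin n)) {w : ℕ → ℕ → ℝ} (h : ∀ a b, 0 ≤ w a b) :
    0 ≤ pairSum σ w := by
  refine Finset.sum_nonneg fun A _ => Finset.sum_nonneg fun B _ => ?_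
  split_ifs
  · exact h _ _
  · exact le_rfl

open Classical in
lemma gibbsMass_eq_pairSum_div (σ : Fin Δ → Equiv.Perm (Fin n)) (lam : ℝ)
    (p : ℕ → ℕ → Prop) :
    gibbsMass (unionOfMatchings σ) lam {I | p I.1.toLeft.card I.1.toRight.card} =
      pairSum σ (fun a b => if p a b then lam ^ (a + b) else 0) /
        partitionFunction (unionOfMatchings σ) lam := by
  have h1 : gibbsMass (unionOfMatchings σ) lam {I | p I.1.toLeft.card I.1.toRight.card} =
      (∑ I : IndepSet (unionOfMatchings σ), if p I.1.toLeft.card I.1.toRight.card then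
        lam ^ (I.1.toLeft.card + I.1.toRight.card) else 0) /
        partitionFunction (unionOfMatchings σ) lam := by
    rw [gibbsMass, Finset.sum_filter, Finset.sum_div]
    refine Finset.sum_congr rfl fun I _ => ?_
    rw [Set.mem_ofPred_eq, gibbs, Finset.card_toLeft_add_card_toRight]
    split_ifs <;> simp
  rw [h1]
  congr 1
  have h2 := Finset.sum_subtype (F := instFintypeIndepSet _) (p := fun X : Finset (Fin n ⊕ Fin n) =>
    (unionOfMatchings σ).IsIndepSet (X : Set (Fin n ⊕ Fin n)))
    (Finset.univ.filter fun X : Finset (Fin n ⊕ Fin n) =>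
      (unionOfMatchings σ).IsIndepSet (X : Set (Fin n ⊕ Fin n))) (fun X => by simp)
    (fun X => if p X.toLeft.card X.toRight.card then
        lam ^ (X.toLeft.card + X.toRight.card) else 0)
  refine h2.symm.trans ?_
  rw [Finset.sum_filter, ← (Finset.sumEquiv (α := Fin n) (β := Fin n)).symm.toEquiv.sum_comp,
    Fintype.sum_prod_type, pairSum]
  refine Finset.sum_congr rfl fun A _ => Finset.sum_congr rfl fun B _ => ?_
  have e1 : (Finset.sumEquiv (α := Fin n) (β := Fin n)).symm.toEquiv (A, B) = A.disjSum B := rfl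
  rw [e1, if_congr (isIndepSet_unionOfMatchings_iff σ _) rfl rfl, Finset.toLeft_disjSum,
    Finset.toRight_disjSum]

/-! ### First moments -/

lemma sum_indicator_compat (A B : Finset (Fin n)) :
    (∑ σ : Fin Δ → Equiv.Perm (Fin n), if Compat σ A B then (1 : ℝ) else 0) =
      (n.factorial : ℝ) ^ Δ * avoidProb n A.card B.card ^ Δ := by
  have h := Finset.prod_univ_sum (fun _ : Fin Δ => (Finset.univ : Finset (Equiv.Perm (Fin n))))
    (fun _ π => if Disjoint B (A.map π.toEmbedding) then (1 : ℝ) else 0)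
  rw [Fintype.piFinset_univ] at h
  rw [Finset.prod_congr rfl (fun κ _ => (Finset.sum_boole _ _).trans (card_perm_avoid A B)),
    Finset.prod_const, Finset.card_univ, Fintype.card_fin, mul_pow] at h
  rw [h]
  refine Finset.sum_congr rfl fun σ _ => ?_
  by_cases hc : Compat σ A B
  · rw [if_pos hc]
    exact (Finset.prod_eq_one fun κ _ => if_pos (hc κ)).symm
  · rw [if_neg hc]
    obtain ⟨κ, hκ⟩ := not_forall.1 hc
    exact (Finset.prod_eq_zero (Finset.mem_univ κ) (if_neg hκ)).symm

lemma sum_pairSum (w : ℕ → ℕ → ℝ) :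
    ∑ σ : Fin Δ → Equiv.Perm (Fin n), pairSum σ w = (n.factorial : ℝ) ^ Δ *
      ∑ a ∈ Finset.range (n + 1), ∑ b ∈ Finset.range (n + 1), w a b * expectedCount Δ n a b := by
  simp only [pairSum]
  rw [Finset.sum_comm]
  have h1 : ∀ A B : Finset (Fin n), (∑ σ : Fin Δ → Equiv.Perm (Fin n),
      if Compat σ A B then w A.card B.card else 0) =
      (n.factorial : ℝ) ^ Δ * (w A.card B.card * avoidProb n A.card B.card ^ Δ) := by
    intro A B
    rw [mul_left_comm, ← sum_indicator_compat, Finset.mul_sum]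
    refine Finset.sum_congr rfl fun σ _ => ?_
    split_ifs <;> simp
  have hcard : ∀ f : ℕ → ℝ, ∑ A : Finset (Fin n), f A.card =
      ∑ a ∈ Finset.range (n + 1), (n.choose a : ℝ) * f a := by
    intro f
    have := Finset.sum_powerset_apply_card f (x := (Finset.univ : Finset (Fin n)))
    simpa using this
  calc _ = ∑ A : Finset (Fin n), ∑ B : Finset (Fin n),
        (n.factorial : ℝ) ^ Δ * (w A.card B.card * avoidProb n A.card B.card ^ Δ) := by
        refine Finset.sum_congr rfl fun A _ => ?_
        rw [Finset.sum_comm]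
        exact Finset.sum_congr rfl fun B _ => h1 A B
    _ = ∑ A : Finset (Fin n), ∑ b ∈ Finset.range (n + 1), (n.choose b : ℝ) *
        ((n.factorial : ℝ) ^ Δ * (w A.card b * avoidProb n A.card b ^ Δ)) :=
        Finset.sum_congr rfl fun A _ => hcard fun b =>
          (n.factorial : ℝ) ^ Δ * (w A.card b * avoidProb n A.card b ^ Δ)
    _ = ∑ a ∈ Finset.range (n + 1), (n.choose a : ℝ) * ∑ b ∈ Finset.range (n + 1),
        (n.choose b : ℝ) * ((n.factorial : ℝ) ^ Δ * (w a b * avoidProb n a b ^ Δ)) :=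
        hcard fun a => ∑ b ∈ Finset.range (n + 1),
          (n.choose b : ℝ) * ((n.factorial : ℝ) ^ Δ * (w a b * avoidProb n a b ^ Δ))
    _ = _ := by
        rw [Finset.mul_sum]
        refine Finset.sum_congr rfl fun a _ => ?_
        rw [Finset.mul_sum, Finset.mul_sum]
        refine Finset.sum_congr rfl fun b _ => ?_
        rw [expectedCount]; ring

open Classical in
/-- Markov's inequality for weighted numbers of independent sets. -/
lemma card_large_pairSum_le (hn : 0 < n) (hΔ : 0 < Δ) {w : ℕ → ℕ → ℝ} (hw : ∀ a b, 0 ≤ w a b)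
    {M : ℝ} (hM : ∀ a b, a + b ≤ n →
      w a b * Real.exp (n * betheEntropy Δ (a / n) (b / n)) ≤ Real.exp (n * M)) :
    ((Finset.univ.filter fun σ : Fin Δ → Equiv.Perm (Fin n) =>
      ¬ pairSum σ w ≤ (n + 1) ^ (Δ + 3) * Real.exp (n * M)).card : ℝ) * (n + 1) ≤
      (n.factorial : ℝ) ^ Δ := by
  -- `Δ` factors come from `expectedCount_le` and two from the number of pairs `(a, b)`. The
  -- remaining factor in the threshold is Markov's, giving failure probability at most `1 / (n +
  -- 1)`.
  set K : ℝ := (n + 1) ^ (Δ + 2) * Real.exp (n * M) with hK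
  have hKpos : 0 < K := by positivity
  have hmom : ∑ a ∈ Finset.range (n + 1), ∑ b ∈ Finset.range (n + 1),
      w a b * expectedCount Δ n a b ≤ K := by
    have hterm : ∀ a b, w a b * expectedCount Δ n a b ≤ (n + 1) ^ Δ * Real.exp (n * M) := by
      intro a b
      rcases le_or_gt (a + b) n with h | h
      · calc w a b * expectedCount Δ n a b ≤
            w a b * ((n + 1) ^ Δ * Real.exp (n * betheEntropy Δ (a / n) (b / n))) :=
              mul_le_mul_of_nonneg_left (expectedCount_le hn h) (hw _ _)
          _ = (n + 1) ^ Δ * (w a b * Real.exp (n * betheEntropy Δ (a / n) (b / n))) := by ring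
          _ ≤ _ := mul_le_mul_of_nonneg_left (hM a b h) (by positivity)
      · have : expectedCount Δ n a b = 0 := by
          -- For `b = 0` truncated subtraction makes `avoidProb` nonzero, but then `n.choose a`
          -- vanishes.
          rcases Nat.eq_zero_or_pos b with rfl | hb
          · rw [expectedCount, Nat.choose_eq_zero_of_lt (by omega)]; simp
          · rw [expectedCount, avoidProb, Nat.choose_eq_zero_of_lt (show n - a < b by omega)]
            simp [hΔ.ne']
        rw [this, mul_zero]; positivity
    refine (Finset.sum_le_sum fun a _ => Finset.sum_le_sum fun b _ => hterm a b).trans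
      (le_of_eq ?_)
    simp only [Finset.sum_const, Finset.card_range, nsmul_eq_mul]
    push_cast
    rw [hK]; ring
  have h1 : ∑ σ : Fin Δ → Equiv.Perm (Fin n), pairSum σ w ≤ (n.factorial : ℝ) ^ Δ * K := by
    rw [sum_pairSum]; exact mul_le_mul_of_nonneg_left hmom (by positivity)
  have h2 : ((Finset.univ.filter fun σ : Fin Δ → Equiv.Perm (Fin n) =>
      ¬ pairSum σ w ≤ (n + 1) ^ (Δ + 3) * Real.exp (n * M)).card : ℝ) * ((n + 1) * K) ≤
      ∑ σ : Fin Δ → Equiv.Perm (Fin n), pairSum σ w := by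
    rw [← nsmul_eq_mul]
    refine (Finset.card_nsmul_le_sum _ (fun σ => pairSum σ w) _ fun σ hσ => ?_).trans
      (Finset.sum_le_sum_of_subset_of_nonneg (Finset.filter_subset _ _)
        fun σ _ _ => pairSum_nonneg σ hw)
    have := (Finset.mem_filter.1 hσ).2
    push Not at this
    refine le_trans (le_of_eq ?_) this.le
    rw [hK]; ring
  refine le_of_mul_le_mul_right ?_ hKpos
  linarith

open Classical in
/-- A property holds asymptotically almost surely if the number of exceptional tuples of
permutations is eventually a vanishing fraction. -/
lemma asymptoticallyAlmostSurely_of_card_le {Δ : ℕ} {Q : ∀ n, SimpleGraph (Fin n ⊕ Fin n) → Prop}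
    (C : ℝ) (h : ∀ᶠ n : ℕ in Filter.atTop,
      ((Finset.univ.filter fun σ : Fin Δ → Equiv.Perm (Fin n) =>
        ¬ Q n (unionOfMatchings σ)).card : ℝ) * (n + 1) ≤ C * (n.factorial : ℝ) ^ Δ) :
    AsymptoticallyAlmostSurely Δ Q := by
  set good : ℕ → ℝ := fun n => ((Finset.univ.filter fun σ : Fin Δ → Equiv.Perm (Fin n) =>
        Q n (unionOfMatchings σ)).card : ℝ) / (n.factorial : ℝ) ^ Δ with hgood
  have hsum : ∀ n, ((Finset.univ.filter fun σ : Fin Δ → Equiv.Perm (Fin n) =>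
        Q n (unionOfMatchings σ)).card : ℝ) +
      ((Finset.univ.filter fun σ : Fin Δ → Equiv.Perm (Fin n) =>
        ¬ Q n (unionOfMatchings σ)).card : ℝ) = (n.factorial : ℝ) ^ Δ := by
    intro n
    have := Finset.card_filter_add_card_filter_not (s := (Finset.univ :
      Finset (Fin Δ → Equiv.Perm (Fin n)))) (fun σ => Q n (unionOfMatchings σ))
    rw [Finset.card_univ, Fintype.card_fun, Fintype.card_perm, Fintype.card_fin,
      Fintype.card_fin] at this
    exact_mod_cast this
  have hfac : ∀ n : ℕ, (0 : ℝ) < (n.factorial : ℝ) ^ Δ := fun n => by positivity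
  have hlim : Filter.Tendsto good Filter.atTop (nhds 1) := by
    have h1 : Filter.Tendsto (fun n : ℕ => 1 - C * (1 / ((n : ℝ) + 1))) Filter.atTop
        (nhds (1 - C * 0)) :=
      tendsto_const_nhds.sub (tendsto_one_div_add_atTop_nhds_zero_nat.const_mul C)
    rw [mul_zero, sub_zero] at h1
    refine tendsto_of_tendsto_of_tendsto_of_le_of_le' h1 tendsto_const_nhds ?_
      (Filter.Eventually.of_forall fun n => ?_)
    · filter_upwards [h] with n hn
      rw [hgood, le_div_iff₀ (hfac n)]
      have h3 : (0 : ℝ) < (n : ℝ) + 1 := by positivity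
      have h4 : ((Finset.univ.filter fun σ : Fin Δ → Equiv.Perm (Fin n) =>
        ¬ Q n (unionOfMatchings σ)).card : ℝ) ≤
          C * (1 / ((n : ℝ) + 1)) * (n.factorial : ℝ) ^ Δ := by
        rw [← le_div_iff₀ h3] at hn
        refine hn.trans (le_of_eq ?_)
        ring
      linarith [hsum n]
    · rw [hgood, div_le_one (hfac n), ← hsum n]
      exact le_add_of_nonneg_right (Nat.cast_nonneg _)
  have h5 := (ENNReal.continuous_ofReal.tendsto 1).comp hlim
  rw [ENNReal.ofReal_one] at h5
  refine h5.congr fun n => ?_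
  rw [randomGraph, PMF.toOuterMeasure_map_apply, PMF.toOuterMeasure_uniformOfFintype_apply]
  simp only [Function.comp, hgood]
  rw [ENNReal.ofReal_div_of_pos (hfac n), ENNReal.ofReal_natCast, Fintype.card_fun,
    Fintype.card_perm, Fintype.card_fin, Fintype.card_fin, ← Nat.cast_pow, ENNReal.ofReal_natCast]
  congr 2
  rw [Fintype.card_subtype]
  rfl

end Pairs

end HardCore

namespace HardCore

/-! ### Finite Markov chains -/

section Chain

variable {Ω : Type*} [Fintype Ω] [DecidableEq Ω] {P : Matrix Ω Ω ℝ}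

lemma pow_apply_nonneg (h0 : ∀ i j, 0 ≤ P i j) (t : ℕ) (i j : Ω) : 0 ≤ (P ^ t) i j := by
  induction t generalizing j with
  | zero => rw [pow_zero, Matrix.one_apply]; split_ifs <;> norm_num
  | succ t ih =>
    rw [pow_succ, Matrix.mul_apply]
    exact Finset.sum_nonneg fun k _ => mul_nonneg (ih k) (h0 k j)

lemma sum_pow_apply (h1 : ∀ i, ∑ j, P i j = 1) (t : ℕ) (i : Ω) : ∑ j, (P ^ t) i j = 1 := by
  induction t with
  | zero => simp [Matrix.one_apply]
  | succ t ih =>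
    simp only [pow_succ, Matrix.mul_apply]
    rw [Finset.sum_comm]
    simp only [← Finset.mul_sum, h1, mul_one, ih]

lemma sum_mul_pow_apply {μ : Ω → ℝ} (hμ : ∀ j, ∑ i, μ i * P i j = μ j) (t : ℕ) (j : Ω) :
    ∑ i, μ i * (P ^ t) i j = μ j := by
  induction t generalizing j with
  | zero => simp [Matrix.one_apply]
  | succ t ih =>
    simp only [pow_succ, Matrix.mul_apply, Finset.mul_sum]
    rw [Finset.sum_comm]
    simp only [← mul_assoc, ← Finset.sum_mul, ih, hμ]

/-- Subtracting `c` from column `o` does not change the action on vectors of total mass `0`, and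
leaves a nonnegative matrix with row sums `1 - c`. -/
lemma sum_abs_mul_le {c : ℝ} {o : Ω} (h0 : ∀ i j, 0 ≤ P i j) (h1 : ∀ i, ∑ j, P i j = 1)
    (hc : ∀ i, c ≤ P i o) {d : Ω → ℝ} (hd : ∑ i, d i = 0) :
    ∑ j, |∑ i, d i * P i j| ≤ (1 - c) * ∑ i, |d i| := by
  set P' : Ω → Ω → ℝ := fun i j => P i j - if j = o then c else 0 with hP'
  have hP0 : ∀ i j, 0 ≤ P' i j := by
    intro i j
    simp only [hP']
    split_ifs with h
    · subst h; linarith [hc i]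
    · linarith [h0 i j]
  have hP1 : ∀ i, ∑ j, P' i j = 1 - c := by
    intro i
    simp [hP', Finset.sum_sub_distrib, h1]
  have e : ∀ j, ∑ i, d i * P i j = ∑ i, d i * P' i j := by
    intro j
    simp only [hP', mul_sub, Finset.sum_sub_distrib, ← Finset.sum_mul, hd, zero_mul, sub_zero]
  calc ∑ j, |∑ i, d i * P i j| ≤ ∑ j, ∑ i, |d i| * P' i j := by
        refine Finset.sum_le_sum fun j _ => ?_
        rw [e]
        refine (Finset.abs_sum_le_sum_abs _ _).trans (Finset.sum_le_sum fun i _ => ?_)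
        rw [abs_mul, abs_of_nonneg (hP0 i j)]
    _ = (1 - c) * ∑ i, |d i| := by
        rw [Finset.sum_comm, Finset.mul_sum]
        refine Finset.sum_congr rfl fun i _ => ?_
        rw [← Finset.mul_sum, hP1, mul_comm]

/-- Doeblin's condition implies convergence to the stationary distribution. -/
theorem exists_pow_close_of_doeblin {m : ℕ} {c : ℝ} {o : Ω} {μ : Ω → ℝ} (hc0 : 0 < c)
    (h0 : ∀ i j, 0 ≤ P i j) (h1 : ∀ i, ∑ j, P i j = 1) (hc : ∀ i, c ≤ (P ^ m) i o)
    (hμ : ∀ j, ∑ i, μ i * P i j = μ j) (hμ0 : ∀ i, 0 ≤ μ i) (hμ1 : ∑ i, μ i = 1) {ε : ℝ}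
    (hε : 0 < ε) : ∃ T, ∀ i, ∑ j, |(P ^ T) i j - μ j| ≤ ε := by
  have hstep : ∀ t i, ∑ j, |(P ^ (m * t)) i j - μ j| ≤ (1 - c) ^ t * 2 := by
    intro t i
    induction t with
    | zero =>
      rw [mul_zero, pow_zero, pow_zero, one_mul]
      calc ∑ j, |(1 : Matrix Ω Ω ℝ) i j - μ j| ≤ ∑ j, ((1 : Matrix Ω Ω ℝ) i j + μ j) := by
            refine Finset.sum_le_sum fun j _ => (abs_sub _ _).trans (le_of_eq ?_)
            rw [abs_of_nonneg (hμ0 j), abs_of_nonneg]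
            rw [Matrix.one_apply]; split_ifs <;> norm_num
        _ = 2 := by
            rw [Finset.sum_add_distrib, hμ1]; simp [Matrix.one_apply]; norm_num
    | succ t ih =>
      have e : ∀ j, (P ^ (m * (t + 1))) i j - μ j =
          ∑ k, ((P ^ (m * t)) i k - μ k) * (P ^ m) k j := by
        intro j
        simp only [sub_mul, Finset.sum_sub_distrib]
        rw [sum_mul_pow_apply hμ, mul_add, mul_one, pow_add, Matrix.mul_apply]
      simp only [e]
      refine (sum_abs_mul_le (pow_apply_nonneg h0 m) (sum_pow_apply h1 m) hc ?_).trans ?_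
      · rw [Finset.sum_sub_distrib, sum_pow_apply h1, hμ1, sub_self]
      · have hc1 : c ≤ 1 := by
          refine (hc i).trans ?_
          rw [← sum_pow_apply h1 m i]
          exact Finset.single_le_sum (fun j _ => pow_apply_nonneg h0 m i j) (Finset.mem_univ o)
        rw [pow_succ', mul_assoc]
        exact mul_le_mul_of_nonneg_left ih (by linarith)
  by_cases hΩ : Nonempty Ω
  · obtain ⟨i₀⟩ := hΩ
    have hc1 : c ≤ 1 := by
      refine (hc i₀).trans ?_
      rw [← sum_pow_apply h1 m i₀]
      exact Finset.single_le_sum (fun j _ => pow_apply_nonneg h0 m i₀ j) (Finset.mem_univ o)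
    obtain ⟨t, ht⟩ := exists_pow_lt_of_lt_one (show 0 < ε / 2 by linarith)
      (show 1 - c < 1 by linarith)
    exact ⟨m * t, fun i => (hstep t i).trans (by linarith)⟩
  · exact ⟨0, fun i => (hΩ ⟨i⟩).elim⟩

/-- The probability of having left `S` within `t` steps is at most `t` times the mass of a
bottleneck `B` through which every exit from `S` leads. -/
lemma sum_escape_le {μ : Ω → ℝ} (h0 : ∀ i j, 0 ≤ P i j) (h1 : ∀ i, ∑ j, P i j = 1)
    (hμ : ∀ j, ∑ i, μ i * P i j = μ j) (hμ0 : ∀ i, 0 ≤ μ i) {S B : Finset Ω}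
    (hexit : ∀ i ∈ S, ∀ j ∉ S, j ∉ B → P i j = 0) (t : ℕ) :
    ∑ j ∈ Sᶜ, ∑ i ∈ S, μ i * (P ^ t) i j ≤ t * ∑ j ∈ B, μ j := by
  induction t with
  | zero =>
    simp only [pow_zero, Nat.cast_zero, zero_mul]
    refine le_of_eq (Finset.sum_eq_zero fun j hj => Finset.sum_eq_zero fun i hi => ?_)
    rw [Matrix.one_apply_ne, mul_zero]
    rintro rfl
    exact Finset.mem_compl.1 hj hi
  | succ t ih =>
    -- `ν` is the law at time `t` started from `μ` restricted to `S`; stationarity gives `ν ≤ μ`.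
    -- Mass outside `S` one step later was outside already or has just entered through `B`.
    set ν : Ω → ℝ := fun k => ∑ i ∈ S, μ i * (P ^ t) i k with hν
    have hν0 : ∀ k, 0 ≤ ν k := fun k => Finset.sum_nonneg fun i _ =>
      mul_nonneg (hμ0 i) (pow_apply_nonneg h0 t i k)
    have hνμ : ∀ k, ν k ≤ μ k := fun k => by
      rw [← sum_mul_pow_apply hμ t k]
      exact Finset.sum_le_sum_of_subset_of_nonneg (Finset.subset_univ _) fun i _ _ =>
        mul_nonneg (hμ0 i) (pow_apply_nonneg h0 t i k)
    have e : ∀ j, ∑ i ∈ S, μ i * (P ^ (t + 1)) i j = ∑ k, ν k * P k j := by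
      intro j
      simp only [hν, pow_succ, Matrix.mul_apply, Finset.mul_sum, Finset.sum_mul]
      rw [Finset.sum_comm]
      simp only [mul_assoc]
    simp only [e]
    rw [Finset.sum_comm, ← Finset.sum_add_sum_compl S]
    have b1 : ∑ k ∈ S, ∑ j ∈ Sᶜ, ν k * P k j ≤ ∑ j ∈ B, μ j := by
      calc ∑ k ∈ S, ∑ j ∈ Sᶜ, ν k * P k j ≤ ∑ k ∈ S, ∑ j ∈ B, μ k * P k j := by
            refine Finset.sum_le_sum fun k hk => ?_
            calc ∑ j ∈ Sᶜ, ν k * P k j ≤ ∑ j ∈ Sᶜ, if j ∈ B then μ k * P k j else 0 := by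
                  refine Finset.sum_le_sum fun j hj => ?_
                  split_ifs with hB
                  · exact mul_le_mul_of_nonneg_right (hνμ k) (h0 k j)
                  · rw [hexit k hk j (Finset.mem_compl.1 hj) hB, mul_zero]
              _ ≤ ∑ j, if j ∈ B then μ k * P k j else 0 :=
                  Finset.sum_le_sum_of_subset_of_nonneg (Finset.subset_univ _) fun j _ _ => by
                    split_ifs
                    · exact mul_nonneg (hμ0 k) (h0 k j)
                    · exact le_rfl
              _ = _ := by rw [← Finset.sum_filter]; simp
        _ ≤ ∑ k, ∑ j ∈ B, μ k * P k j :=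
            Finset.sum_le_sum_of_subset_of_nonneg (Finset.subset_univ _) fun k _ _ =>
              Finset.sum_nonneg fun j _ => mul_nonneg (hμ0 k) (h0 k j)
        _ = ∑ j ∈ B, μ j := by
            rw [Finset.sum_comm]; exact Finset.sum_congr rfl fun j _ => hμ j
    have b2 : ∑ k ∈ Sᶜ, ∑ j ∈ Sᶜ, ν k * P k j ≤ t * ∑ j ∈ B, μ j := by
      refine le_trans (Finset.sum_le_sum fun k _ => ?_) ih
      rw [← Finset.mul_sum]
      calc ν k * ∑ j ∈ Sᶜ, P k j ≤ ν k * ∑ j, P k j :=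
            mul_le_mul_of_nonneg_left (Finset.sum_le_sum_of_subset_of_nonneg
              (Finset.subset_univ _) fun j _ _ => h0 k j) (hν0 k)
        _ = ν k := by rw [h1, mul_one]
    push_cast
    linarith

/-- The bottleneck lower bound for the time needed to get close to the stationary distribution. -/
theorem bottleneck {μ : Ω → ℝ} (h0 : ∀ i j, 0 ≤ P i j) (h1 : ∀ i, ∑ j, P i j = 1)
    (hμ : ∀ j, ∑ i, μ i * P i j = μ j) (hμ0 : ∀ i, 0 ≤ μ i) (hμ1 : ∑ i, μ i = 1)
    {S B : Finset Ω} (hexit : ∀ i ∈ S, ∀ j ∉ S, j ∉ B → P i j = 0)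
    (hS : ∑ i ∈ S, μ i ≤ 1 / 2) {T : ℕ}
    (hT : ∀ i, (1 / 2) * ∑ j, |(P ^ T) i j - μ j| ≤ 1 / 4) :
    (∑ i ∈ S, μ i) / 4 ≤ T * ∑ j ∈ B, μ j := by
  have hSc : ∑ j ∈ Sᶜ, μ j = 1 - ∑ j ∈ S, μ j := by
    rw [← hμ1, ← Finset.sum_add_sum_compl S μ]; ring
  -- The complement of `S` has mass at least `1 / 2`, and total variation distance `1 / 4` can
  -- remove at most `1 / 4` of it.
  have htv : ∀ i, 1 / 4 ≤ ∑ j ∈ Sᶜ, (P ^ T) i j := by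
    intro i
    have e1 : ∑ j, ((P ^ T) i j - μ j) = 0 := by
      rw [Finset.sum_sub_distrib, sum_pow_apply h1, hμ1, sub_self]
    rw [← Finset.sum_add_sum_compl S] at e1
    have e2 := hT i
    rw [← Finset.sum_add_sum_compl S] at e2
    have e3 : ∑ j ∈ S, ((P ^ T) i j - μ j) ≤ ∑ j ∈ S, |(P ^ T) i j - μ j| :=
      Finset.sum_le_sum fun j _ => le_abs_self _
    have e4 : -∑ j ∈ Sᶜ, ((P ^ T) i j - μ j) ≤ ∑ j ∈ Sᶜ, |(P ^ T) i j - μ j| := by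
      rw [← Finset.sum_neg_distrib]
      exact Finset.sum_le_sum fun j _ => neg_le_abs _
    rw [Finset.sum_sub_distrib _ _ (s := Sᶜ)] at e1 e4
    linarith
  refine le_trans ?_ (sum_escape_le h0 h1 hμ hμ0 hexit T)
  rw [Finset.sum_comm, Finset.sum_div]
  refine Finset.sum_le_sum fun i _ => ?_
  rw [← Finset.mul_sum]
  have := mul_le_mul_of_nonneg_left (htv i) (hμ0 i)
  linarith

end Chain

/-! ### The Glauber dynamics -/

/-- A rejected proposal returns `I`, so a move to `J ≠ I` must propose exactly `J`. -/
lemma accept_eq_iff_of_ne {V : Type*} [DecidableEq V] (G : SimpleGraph V)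
    {I J : IndepSet G} (h : I ≠ J) (X : Finset V) :
    accept G I X = J ↔ X = J.1 := by
  unfold accept
  split_ifs with hX
  · exact Subtype.ext_iff
  · refine ⟨fun hh => (h hh).elim, ?_⟩
    rintro rfl
    exact (hX J.2).elim

section Glauber

variable {V : Type*} [Fintype V] [DecidableEq V] (G : SimpleGraph V) {lam : ℝ}

/-- The empty independent set. -/
def emptyIndep : IndepSet G := ⟨∅, by simp [SimpleGraph.IsIndepSet]⟩

lemma partitionFunction_pos (hl : 0 < lam) : 0 < partitionFunction G lam :=
  Finset.sum_pos (fun I _ => by positivity) ⟨emptyIndep G, Finset.mem_univ _⟩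

lemma gibbs_pos (hl : 0 < lam) (I : IndepSet G) : 0 < gibbs G lam I :=
  div_pos (by positivity) (partitionFunction_pos G hl)

lemma sum_gibbs (hl : 0 < lam) : ∑ I, gibbs G lam I = 1 := by
  simp only [gibbs, ← Finset.sum_div]
  exact div_self (partitionFunction_pos G hl).ne'

lemma glauber_nonneg (hl : 0 < lam) (I J : IndepSet G) : 0 ≤ glauber G lam I J := by
  unfold glauber
  positivity

lemma sum_glauber [Nonempty V] (hl : 0 < lam) (I : IndepSet G) : ∑ J, glauber G lam I J = 1 := by
  unfold glauber
  rw [Finset.sum_comm]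
  simp only [← Finset.mul_sum, Finset.sum_add_distrib, Finset.sum_ite_eq, Finset.mem_univ, if_true]
  rw [Finset.sum_const, Finset.card_univ, nsmul_eq_mul]
  have : (Fintype.card V : ℝ) ≠ 0 := by exact_mod_cast Fintype.card_ne_zero
  field_simp
  ring

lemma glauber_reversible (I J : IndepSet G) :
    lam ^ I.1.card * glauber G lam I J = lam ^ J.1.card * glauber G lam J I := by
  rcases eq_or_ne I J with rfl | hne
  · rfl
  have key : ∀ {I J : IndepSet G}, I ≠ J → ∀ v,
      lam ^ I.1.card * (lam * (if insert v I.1 = J.1 then 1 else 0)) =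
        lam ^ J.1.card * (if J.1.erase v = I.1 then 1 else 0) := by
    intro I J hne v
    have hne' : I.1 ≠ J.1 := fun h => hne (Subtype.ext h)
    by_cases h : insert v I.1 = J.1
    · have hv : v ∉ I.1 := fun hv => hne' (by rw [← h, Finset.insert_eq_of_mem hv])
      have h2 : J.1.erase v = I.1 := by rw [← h, Finset.erase_insert hv]
      rw [if_pos h, if_pos h2, ← h, Finset.card_insert_of_notMem hv, pow_succ]
      ring
    · have h2 : J.1.erase v ≠ I.1 := by
        intro h2
        by_cases hv : v ∈ J.1
        · exact h (by rw [← h2, Finset.insert_erase hv])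
        · exact hne' (by rw [← h2, Finset.erase_eq_of_notMem hv])
      rw [if_neg h, if_neg h2]; ring
  unfold glauber
  rw [Finset.mul_sum, Finset.mul_sum]
  refine Finset.sum_congr rfl fun v _ => ?_
  simp only [accept_eq_iff_of_ne G hne, accept_eq_iff_of_ne G hne.symm]
  have k1 := key hne v
  have k2 := key hne.symm v
  -- Detailed balance pairs inserting `v` in one direction with erasing `v` in the other.
  linear_combination (1 / (Fintype.card V : ℝ) * (1 / (1 + lam))) * (k1 - k2)

lemma gibbs_stationary [Nonempty V] (hl : 0 < lam) (J : IndepSet G) :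
    ∑ I, gibbs G lam I * glauber G lam I J = gibbs G lam J := by
  have : ∀ I, gibbs G lam I * glauber G lam I J = gibbs G lam J * glauber G lam J I := by
    intro I
    rw [gibbs, gibbs, div_mul_eq_mul_div, div_mul_eq_mul_div, glauber_reversible]
  rw [Finset.sum_congr rfl fun I _ => this I, ← Finset.mul_sum, sum_glauber G hl, mul_one]

/-- Erasures are always accepted. For `s` the whole vertex set this reaches the empty set from
anywhere, which is Doeblin's condition. -/
lemma glauber_pow_sdiff [Nonempty V] (hl : 0 < lam) (I : IndepSet G) (s : Finset V) :
    ∃ J : IndepSet G, J.1 = I.1 \ s ∧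
      (1 / (Fintype.card V : ℝ) * (1 / (1 + lam))) ^ s.card ≤ (glauber G lam ^ s.card) I J := by
  induction s using Finset.induction_on with
  | empty => exact ⟨I, by simp, by simp⟩
  | insert v s hv ih =>
    obtain ⟨J, hJ, hp⟩ := ih
    have hind : G.IsIndepSet ((J.1.erase v : Finset V) : Set V) :=
      Set.Pairwise.mono (by exact_mod_cast Finset.erase_subset v J.1) J.2
    refine ⟨⟨J.1.erase v, hind⟩, ?_, ?_⟩
    · change J.1.erase v = _
      rw [hJ]; ext x; simp; tauto
    · rw [Finset.card_insert_of_notMem hv, pow_succ, pow_succ, Matrix.mul_apply]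
      have hstep : 1 / (Fintype.card V : ℝ) * (1 / (1 + lam)) ≤
          glauber G lam J ⟨J.1.erase v, hind⟩ := by
        unfold glauber
        refine le_trans ?_ (Finset.single_le_sum (fun w _ => by positivity) (Finset.mem_univ v))
        have : accept G J (J.1.erase v) = ⟨J.1.erase v, hind⟩ := dif_pos hind
        rw [if_pos this, mul_one]
        refine mul_le_mul_of_nonneg_left ?_ (by positivity)
        exact le_add_of_nonneg_left (by positivity)
      refine (mul_le_mul hp hstep (by positivity)
        (pow_apply_nonneg (glauber_nonneg G hl) _ _ _)).trans ?_
      exact Finset.single_le_sum (f := fun K => (glauber G lam ^ s.card) I K *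
        glauber G lam K ⟨J.1.erase v, hind⟩)
        (fun K _ => mul_nonneg (pow_apply_nonneg (glauber_nonneg G hl) _ _ _)
        (glauber_nonneg G hl _ _)) (Finset.mem_univ J)

/-- The Glauber dynamics mixes, so that the mixing time is attained. -/
lemma tvToGibbs_mixingTime_le [Nonempty V] (hl : 0 < lam) (I : IndepSet G) :
    tvToGibbs G lam (mixingTime G lam) I ≤ 1 / 4 := by
  -- Nonemptiness is essential: `sInf ∅ = 0` in `ℕ`, which would make the mixing time meaningless.
  have hne : {T : ℕ | ∀ I : IndepSet G, tvToGibbs G lam T I ≤ 1 / 4}.Nonempty := by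
    obtain ⟨T, hT⟩ := exists_pow_close_of_doeblin (P := glauber G lam) (o := emptyIndep G)
      (m := (Finset.univ : Finset V).card)
      (c := (1 / (Fintype.card V : ℝ) * (1 / (1 + lam))) ^ (Finset.univ : Finset V).card)
      (μ := gibbs G lam)
      (by have : (0 : ℝ) < Fintype.card V := by exact_mod_cast Fintype.card_pos
          positivity)
      (glauber_nonneg G hl) (sum_glauber G hl)
      (fun I => by
        obtain ⟨J, hJ, hp⟩ := glauber_pow_sdiff G hl I Finset.univ
        have : J = emptyIndep G := Subtype.ext (by rw [hJ]; simp [emptyIndep])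
        rwa [this] at hp)
      (gibbs_stationary G hl) (fun I => (gibbs_pos G hl I).le) (sum_gibbs G hl)
      (show (0 : ℝ) < 1 / 2 by norm_num)
    refine ⟨T, fun I => ?_⟩
    have := hT I
    unfold tvToGibbs
    linarith
  exact Nat.sInf_mem hne I

lemma exists_of_glauber_ne_zero {I J : IndepSet G} (h : glauber G lam I J ≠ 0) :
    ∃ v, J.1 ⊆ insert v I.1 ∧ I.1 ⊆ insert v J.1 := by
  unfold glauber at h
  obtain ⟨v, -, hv⟩ := Finset.exists_ne_zero_of_sum_ne_zero h
  refine ⟨v, ?_⟩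
  rcases eq_or_ne I J with rfl | hne
  · exact ⟨Finset.subset_insert _ _, Finset.subset_insert _ _⟩
  simp only [accept_eq_iff_of_ne G hne] at hv
  by_cases h1 : insert v I.1 = J.1
  · rw [← h1]
    exact ⟨subset_rfl, (Finset.subset_insert _ _).trans (Finset.subset_insert _ _)⟩
  · by_cases h2 : I.1.erase v = J.1
    · rw [← h2]
      exact ⟨(Finset.erase_subset _ _).trans (Finset.subset_insert _ _),
        Finset.subset_insert_iff.2 subset_rfl⟩
    · simp [h1, h2] at hv

end Glauber

/-! ### Torpid mixing from a bottleneck of balanced sets -/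

section Torpid

variable {n : ℕ} (G : SimpleGraph (Fin n ⊕ Fin n)) {lam δ : ℝ}

lemma card_toLeft_le_of_subset_insert {X Y : Finset (Fin n ⊕ Fin n)} {v : Fin n ⊕ Fin n}
    (h : X ⊆ insert v Y) : X.toLeft.card ≤ Y.toLeft.card + 1 := by
  refine (Finset.card_le_card (Finset.toLeft_subset_toLeft h)).trans ?_
  rcases v with v | v
  · rw [Finset.toLeft_insert_inl]; exact Finset.card_insert_le _ _
  · rw [Finset.toLeft_insert_inr]; exact Nat.le_succ _

lemma card_toRight_le_of_subset_insert {X Y : Finset (Fin n ⊕ Fin n)} {v : Fin n ⊕ Fin n}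
    (h : X ⊆ insert v Y) : X.toRight.card ≤ Y.toRight.card + 1 := by
  refine (Finset.card_le_card (Finset.toRight_subset_toRight h)).trans ?_
  rcases v with v | v
  · rw [Finset.toRight_insert_inl]; exact Nat.le_succ _
  · rw [Finset.toRight_insert_inr]; exact Finset.card_insert_le _ _

/-- One step changes each side's count by at most one, hence their difference by at most `2`,
whereas crossing requires more than `2 * δ * n ≥ 2`. -/
lemma glauber_biased_eq_zero (hδ : 1 ≤ δ * n) {I J : IndepSet G}
    (h : I ∈ biasedLeft G δ ∧ J ∈ biasedRight G δ ∨ I ∈ biasedRight G δ ∧ J ∈ biasedLeft G δ) :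
    glauber G lam I J = 0 := by
  by_contra hne
  obtain ⟨v, h1, h2⟩ := exists_of_glauber_ne_zero G hne
  have a1 : (J.1.toLeft.card : ℝ) ≤ I.1.toLeft.card + 1 := by
    exact_mod_cast card_toLeft_le_of_subset_insert h1
  have a2 : (I.1.toLeft.card : ℝ) ≤ J.1.toLeft.card + 1 := by
    exact_mod_cast card_toLeft_le_of_subset_insert h2
  have a3 : (J.1.toRight.card : ℝ) ≤ I.1.toRight.card + 1 := by
    exact_mod_cast card_toRight_le_of_subset_insert h1
  have a4 : (I.1.toRight.card : ℝ) ≤ J.1.toRight.card + 1 := by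
    exact_mod_cast card_toRight_le_of_subset_insert h2
  simp only [biasedLeft, biasedRight, Set.mem_ofPred_eq] at h
  rcases h with ⟨b1, b2⟩ | ⟨b1, b2⟩ <;> linarith

/-- If balanced independent sets are a bottleneck between the biased ones, then the Glauber
dynamics mixes slowly. -/
theorem mixingTime_ge_of_bottleneck (hn : 0 < n) (hl : 0 < lam) (hδ : 1 ≤ δ * n) {r : ℝ}
    (h : gibbsMass G lam (balanced G δ) ≤
      r * min (gibbsMass G lam (biasedLeft G δ)) (gibbsMass G lam (biasedRight G δ))) :
    1 / 4 ≤ mixingTime G lam * r := by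
  classical
  have : Nonempty (Fin n ⊕ Fin n) := ⟨Sum.inl ⟨0, hn⟩⟩
  have hmass : ∀ S : Set (IndepSet G), gibbsMass G lam S =
      ∑ I ∈ Finset.univ.filter (· ∈ S), gibbs G lam I := fun S => by
    unfold gibbsMass; congr!
  have hmass0 : ∀ S : Set (IndepSet G), 0 ≤ gibbsMass G lam S := fun S =>
    Finset.sum_nonneg fun I _ => (gibbs_pos G hl I).le
  -- The empty set is balanced, so the hypothesis forces both `m` and `r` to be positive.
  have hbal : 0 < gibbsMass G lam (balanced G δ) := by
    rw [hmass]
    refine Finset.sum_pos (fun I _ => gibbs_pos G hl I) ⟨emptyIndep G, ?_⟩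
    have h0 : (0 : ℝ) ≤ δ * n := by linarith
    have e1 : (∅ : Finset (Fin n ⊕ Fin n)).toLeft = ∅ := by ext; simp
    have e2 : (∅ : Finset (Fin n ⊕ Fin n)).toRight = ∅ := by ext; simp
    refine Finset.mem_filter.2 ⟨Finset.mem_univ _, ?_, ?_⟩ <;> simpa [emptyIndep, e1, e2] using h0
  set m := min (gibbsMass G lam (biasedLeft G δ)) (gibbsMass G lam (biasedRight G δ)) with hm
  have hm0 : 0 ≤ m := le_min (hmass0 _) (hmass0 _)
  have hmpos : 0 < m := by
    rcases hm0.eq_or_lt with h0 | h0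
    · rw [← h0, mul_zero] at h; linarith
    · exact h0
  have hrpos : 0 < r := by
    by_contra! hr
    have := mul_nonpos_of_nonpos_of_nonneg hr hm0
    linarith
  have hcover : ∀ I : IndepSet G, I ∉ balanced G δ → I ∈ biasedLeft G δ ∨ I ∈ biasedRight G δ := by
    intro I hI
    simp only [balanced, Set.mem_ofPred_eq, not_and_or, not_le] at hI
    exact hI
  have main : ∀ S : Set (IndepSet G), m ≤ gibbsMass G lam S → gibbsMass G lam S ≤ 1 / 2 →
      (∀ I ∈ S, ∀ J ∉ S, J ∉ balanced G δ → glauber G lam I J = 0) →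
      1 / 4 ≤ mixingTime G lam * r := by
    intro S hmS hS hexit
    have key := bottleneck (P := glauber G lam) (μ := gibbs G lam)
      (S := Finset.univ.filter (· ∈ S)) (B := Finset.univ.filter (· ∈ balanced G δ))
      (T := mixingTime G lam)
      (glauber_nonneg G hl) (sum_glauber G hl) (gibbs_stationary G hl)
      (fun I => (gibbs_pos G hl I).le) (sum_gibbs G hl)
      (by simpa using hexit) (by rw [← hmass]; exact hS) (tvToGibbs_mixingTime_le G hl)
    rw [← hmass, ← hmass] at key
    have hSpos : 0 < gibbsMass G lam S := hmpos.trans_le hmS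
    have h2 : gibbsMass G lam (balanced G δ) ≤ r * gibbsMass G lam S :=
      h.trans (mul_le_mul_of_nonneg_left hmS hrpos.le)
    have h3 := key.trans (mul_le_mul_of_nonneg_left h2 (Nat.cast_nonneg (mixingTime G lam)))
    refine le_of_mul_le_mul_right ?_ hSpos
    linarith
  have hsum : gibbsMass G lam (biasedLeft G δ) + gibbsMass G lam (biasedRight G δ) ≤ 1 := by
    rw [hmass, hmass, ← sum_gibbs G hl, ← Finset.sum_union]
    · exact Finset.sum_le_sum_of_subset_of_nonneg (Finset.subset_univ _) fun I _ _ =>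
        (gibbs_pos G hl I).le
    · rw [Finset.disjoint_filter]
      intro I _ h1 h2
      simp only [biasedLeft, biasedRight, Set.mem_ofPred_eq] at h1 h2
      linarith
  -- The lighter biased family has mass at most `1 / 2` and serves as `S`.
  rcases le_total (gibbsMass G lam (biasedLeft G δ)) (gibbsMass G lam (biasedRight G δ))
    with hle | hle
  · refine main _ (min_le_left _ _) (by linarith) fun I hI J hJ hJB => ?_
    exact glauber_biased_eq_zero G hδ (Or.inl ⟨hI, (hcover J hJB).resolve_left hJ⟩)
  · refine main _ (min_le_right _ _) (by linarith) fun I hI J hJ hJB => ?_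
    exact glauber_biased_eq_zero G hδ (Or.inr ⟨hI, (hcover J hJB).resolve_right hJ⟩)

end Torpid

end HardCore

namespace HardCore

/-! ### The biased phases dominate -/

section Phases

variable {n Δ : ℕ}

lemma eventually_two_mul_pow_le_exp (k : ℕ) {b : ℝ} (hb : 0 < b) :
    ∀ᶠ n : ℕ in Filter.atTop, 2 * ((n : ℝ) + 1) ^ k ≤ Real.exp (n * b) := by
  -- The estimate is used at `n + 1`; the factor `exp (-b)` compensates for the shift.
  have h := (isLittleO_pow_exp_pos_mul_atTop k hb).bound
    (show 0 < Real.exp (-b) / 2 by positivity)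
  have h2 : Filter.Tendsto (fun n : ℕ => (n : ℝ) + 1) Filter.atTop Filter.atTop :=
    Filter.tendsto_atTop_add_const_right _ 1 tendsto_natCast_atTop_atTop
  filter_upwards [h2.eventually h] with n hn
  rw [Real.norm_of_nonneg (by positivity), Real.norm_of_nonneg (by positivity)] at hn
  have e : Real.exp (-b) * Real.exp (b * ((n : ℝ) + 1)) = Real.exp (n * b) := by
    rw [← Real.exp_add]; congr 1; ring
  rw [← e]
  linarith

-- Transfer from the model with a field to the one without: outside `p` lies at most half of the
-- lower bound, and `exp (n * s)` bounds the weight the field adds.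
open Classical in
lemma exp_le_two_mul_pairSum (σ : Fin Δ → Equiv.Perm (Fin n)) {l₁ l₂ lam s M η : ℝ} {k : ℕ}
    (p : ℕ → ℕ → Prop) (hZ : Real.exp (n * M) ≤ biPartition σ l₁ l₂)
    (hlow : pairSum σ (fun a b => if p a b then 0 else l₁ ^ a * l₂ ^ b) ≤
      (n + 1) ^ k * Real.exp (n * (M - η)))
    (hpoly : 2 * ((n : ℝ) + 1) ^ k ≤ Real.exp (n * η))
    (hdom : ∀ a ≤ n, ∀ b ≤ n, l₁ ^ a * l₂ ^ b ≤ Real.exp (n * s) * lam ^ (a + b)) :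
    Real.exp (n * (M - s)) ≤ 2 * pairSum σ (fun a b => if p a b then lam ^ (a + b) else 0) := by
  have h1 : biPartition σ l₁ l₂ ≤
      pairSum σ (fun a b => if p a b then 0 else l₁ ^ a * l₂ ^ b) +
        Real.exp (n * s) * pairSum σ (fun a b => if p a b then lam ^ (a + b) else 0) := by
    rw [← pairSum_const_mul, ← pairSum_add]
    refine pairSum_le_pairSum σ (w := fun a b => l₁ ^ a * l₂ ^ b) fun a ha b hb => ?_
    split_ifs
    · rw [zero_add]; exact hdom a ha b hb
    · simp
  have h2 : 2 * ((n + 1) ^ k * Real.exp (n * (M - η))) ≤ Real.exp (n * M) := by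
    have e : Real.exp (n * M) = Real.exp (n * η) * Real.exp (n * (M - η)) := by
      rw [← Real.exp_add]; congr 1; ring
    rw [e, ← mul_assoc]
    exact mul_le_mul_of_nonneg_right hpoly (Real.exp_pos _).le
  have e : Real.exp (n * M) = Real.exp (n * s) * Real.exp (n * (M - s)) := by
    rw [← Real.exp_add]; congr 1; ring
  refine le_of_mul_le_mul_left ?_ (Real.exp_pos (n * s))
  rw [← e]
  linarith

lemma exp_pow_mul_exp (hn : 0 < n) (u v B : ℝ) (a b : ℕ) :
    Real.exp u ^ a * Real.exp v ^ b * Real.exp (n * B) =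
      Real.exp (n * (B + u * (a / n) + v * (b / n))) := by
  have hn' : (n : ℝ) ≠ 0 := by exact_mod_cast hn.ne'
  rw [← Real.exp_nat_mul, ← Real.exp_nat_mul, ← Real.exp_add, ← Real.exp_add]
  congr 1
  field_simp
  ring

lemma density_mem (hn : 0 < n) {a b : ℕ} (h : a + b ≤ n) :
    ((a : ℝ) / n, (b : ℝ) / n) ∈ densityTriangle := by
  have hn' : (0 : ℝ) < n := by exact_mod_cast hn
  refine ⟨by positivity, by positivity, ?_⟩
  simp only
  rw [← add_div, div_le_one hn']
  exact_mod_cast h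

lemma div_le_div_add_iff (hn : 0 < n) {a b : ℕ} {δ : ℝ} :
    (a : ℝ) / n ≤ b / n + δ ↔ (a : ℝ) ≤ b + δ * n := by
  have hn' : (0 : ℝ) < n := by exact_mod_cast hn
  rw [div_add' _ _ _ hn'.ne', div_le_div_iff_of_pos_right hn']

/-- Above the critical activity, balanced independent sets are asymptotically almost surely
exponentially unlikely compared with the biased ones on either side. -/
theorem card_exceptional_le {Δ : ℕ} (hΔ : 3 ≤ Δ) {lam : ℝ} (hlam : criticalActivity Δ < lam)
    (hpos : 0 < lam) :
    ∃ η > 0, ∃ δ > 0, ∀ᶠ n : ℕ in Filter.atTop, ∃ bad : Finset (Fin Δ → Equiv.Perm (Fin n)),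
      (bad.card : ℝ) * (n + 1) ≤ 3 * (n.factorial : ℝ) ^ Δ ∧ ∀ σ ∉ bad,
        gibbsMass (unionOfMatchings σ) lam (balanced (unionOfMatchings σ) δ) ≤
          (Real.exp η ^ n)⁻¹ * min
            (gibbsMass (unionOfMatchings σ) lam (biasedLeft (unionOfMatchings σ) δ))
            (gibbsMass (unionOfMatchings σ) lam (biasedRight (unionOfMatchings σ) δ)) := by
  classical
  obtain ⟨s, hs, δ, hδ, η, hη, q, hq, hnonleft, hbal⟩ := exists_field hΔ hlam
  set M := betheEnergy Δ (Real.log lam) q + s * q.1 with hM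
  -- The other half of `η` absorbs the polynomial factor.
  refine ⟨η / 2, by linarith, δ, hδ, ?_⟩
  filter_upwards [Filter.eventually_gt_atTop 0,
    eventually_two_mul_pow_le_exp (Δ + 3) (show 0 < η / 2 by linarith)] with n hn hpoly
  have hn' : (0 : ℝ) < n := by exact_mod_cast hn
  have hpoly' : 2 * ((n : ℝ) + 1) ^ (Δ + 3) ≤ Real.exp (n * η) :=
    hpoly.trans (Real.exp_le_exp.2 (by nlinarith))
  set l := Real.log lam with hl
  have hexp : lam = Real.exp l := (Real.exp_log hpos).symm
  -- The favoured side has activity `lam * exp s`, the other one `lam`.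
  set L := Real.exp (l + s) with hL
  have hLpos : 0 < L := Real.exp_pos _
  set pL : ℕ → ℕ → Prop := fun a b => (a : ℝ) > b + δ * n with hpL
  set pR : ℕ → ℕ → Prop := fun a b => (b : ℝ) > a + δ * n with hpR
  set pB : ℕ → ℕ → Prop := fun a b => (a : ℝ) ≤ b + δ * n ∧ (b : ℝ) ≤ a + δ * n with hpB
  set wB : ℕ → ℕ → ℝ := fun a b => if pB a b then lam ^ (a + b) else 0 with hwB
  set wL : ℕ → ℕ → ℝ := fun a b => if pL a b then 0 else L ^ a * lam ^ b with hwL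
  set wR : ℕ → ℕ → ℝ := fun a b => if pR a b then 0 else lam ^ a * L ^ b with hwR
  have hΔ0 : 0 < Δ := by omega
  have bB := card_large_pairSum_le (Δ := Δ) (M := M - s - η) hn hΔ0 (w := wB)
    (fun a b => by simp only [hwB]; positivity) (fun a b hab => by
      simp only [hwB]
      split_ifs with h
      · rw [pow_add, hexp, exp_pow_mul_exp hn]
        refine Real.exp_le_exp.2 (mul_le_mul_of_nonneg_left ?_ hn'.le)
        have := hbal _ (density_mem hn hab) (by
          rw [abs_le]
          have h1 := (div_le_div_add_iff hn).2 h.1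
          have h2 := (div_le_div_add_iff hn).2 h.2
          constructor <;> simp only <;> linarith)
        simp only [betheEnergy] at this
        linarith
      · rw [zero_mul]; positivity)
  have bL := card_large_pairSum_le (Δ := Δ) (M := M - η) hn hΔ0 (w := wL)
    (fun a b => by simp only [hwL]; positivity) (fun a b hab => by
      simp only [hwL]
      split_ifs with h
      · rw [zero_mul]; positivity
      · rw [hL, hexp, exp_pow_mul_exp hn]
        refine Real.exp_le_exp.2 (mul_le_mul_of_nonneg_left ?_ hn'.le)
        have := hnonleft _ (density_mem hn hab) ((div_le_div_add_iff hn).2 (not_lt.1 h))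
        simp only [betheEnergy] at this
        linarith)
  have bR := card_large_pairSum_le (Δ := Δ) (M := M - η) hn hΔ0 (w := wR)
    (fun a b => by simp only [hwR]; positivity) (fun a b hab => by
      simp only [hwR]
      split_ifs with h
      · rw [zero_mul]; positivity
      · rw [hL, hexp, exp_pow_mul_exp hn]
        refine Real.exp_le_exp.2 (mul_le_mul_of_nonneg_left ?_ hn'.le)
        have := hnonleft _ (density_mem hn (show b + a ≤ n by omega))
          ((div_le_div_add_iff hn).2 (not_lt.1 h))
        simp only [betheEnergy] at this
        rw [betheEntropy_comm]
        linarith)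
  -- Three Markov events: balanced sets without field, sets that are not left-biased in the left
  -- field, and sets that are not right-biased in the right field.
  refine ⟨(Finset.univ.filter fun σ : Fin Δ → Equiv.Perm (Fin n) =>
      ¬ pairSum σ wB ≤ (n + 1) ^ (Δ + 3) * Real.exp (n * (M - s - η))) ∪
    ((Finset.univ.filter fun σ : Fin Δ → Equiv.Perm (Fin n) =>
      ¬ pairSum σ wL ≤ (n + 1) ^ (Δ + 3) * Real.exp (n * (M - η))) ∪
    (Finset.univ.filter fun σ : Fin Δ → Equiv.Perm (Fin n) =>
      ¬ pairSum σ wR ≤ (n + 1) ^ (Δ + 3) * Real.exp (n * (M - η)))), ?_, ?_⟩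
  · have h1 := Finset.card_union_le (Finset.univ.filter fun σ : Fin Δ → Equiv.Perm (Fin n) =>
      ¬ pairSum σ wB ≤ (n + 1) ^ (Δ + 3) * Real.exp (n * (M - s - η)))
      ((Finset.univ.filter fun σ : Fin Δ → Equiv.Perm (Fin n) =>
      ¬ pairSum σ wL ≤ (n + 1) ^ (Δ + 3) * Real.exp (n * (M - η))) ∪
      (Finset.univ.filter fun σ : Fin Δ → Equiv.Perm (Fin n) =>
      ¬ pairSum σ wR ≤ (n + 1) ^ (Δ + 3) * Real.exp (n * (M - η))))
    have h2 := h1.trans (Nat.add_le_add_left (Finset.card_union_le _ _) _)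
    have h3 : (_ : ℝ) ≤ _ := Nat.cast_le.2 h2
    push_cast at h3
    refine (mul_le_mul_of_nonneg_right h3 (by positivity)).trans ?_
    linarith
  · intro σ hσ
    simp only [Finset.mem_union, Finset.mem_filter, Finset.mem_univ, true_and, not_or,
      not_not] at hσ
    obtain ⟨gB, gL, gR⟩ := hσ
    have hLe : Real.log L = l + s := Real.log_exp _
    have dom : ∀ a ≤ n, ∀ b : ℕ, L ^ a * lam ^ b ≤ Real.exp (n * s) * lam ^ (a + b) := by
      intro a ha b
      have e : L ^ a = Real.exp (a * s) * lam ^ a := by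
        rw [hL, hexp, ← Real.exp_nat_mul, ← Real.exp_nat_mul, ← Real.exp_add]
        congr 1; ring
      rw [e, mul_assoc, ← pow_add]
      refine mul_le_mul_of_nonneg_right (Real.exp_le_exp.2 ?_) (by positivity)
      exact mul_le_mul_of_nonneg_right (by exact_mod_cast ha) hs.le
    have zL : Real.exp (n * M) ≤ biPartition σ L lam := by
      refine le_trans (le_of_eq ?_) (exp_bethe_le_biPartition σ hLpos hpos hq.1 hq.2.1 hq.2.2)
      rw [hLe, hM, betheEnergy, ← hl]
      congr 1; ring
    have zR : Real.exp (n * M) ≤ biPartition σ lam L := by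
      refine le_trans (le_of_eq ?_) (exp_bethe_le_biPartition σ hpos hLpos hq.2.1 hq.1
        (by rw [add_comm]; exact hq.2.2))
      rw [hLe, hM, betheEnergy, betheEntropy_comm, ← hl]
      congr 1; ring
    have massL := exp_le_two_mul_pairSum σ pL zL gL hpoly' fun a ha b _ => dom a ha b
    have massR := exp_le_two_mul_pairSum σ pR zR gR hpoly' fun a _ b hb => by
      rw [mul_comm, add_comm a b]; exact dom b hb a
    have e1 := gibbsMass_eq_pairSum_div σ lam pB
    have e2 := gibbsMass_eq_pairSum_div σ lam pL
    have e3 := gibbsMass_eq_pairSum_div σ lam pR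
    have hZ := partitionFunction_pos (unionOfMatchings σ) hpos
    have hgB : pairSum σ wB ≤
        (Real.exp (η / 2) ^ n)⁻¹ * (Real.exp (n * (M - s)) / 2) := by
      refine gB.trans ?_
      rw [← Real.exp_nat_mul, ← Real.exp_neg]
      have k1 : Real.exp (n * (M - s - η)) =
          Real.exp (-(n * (η / 2))) * (Real.exp (n * (M - s)) * Real.exp (-(n * (η / 2)))) := by
        rw [← Real.exp_add, ← Real.exp_add]; congr 1; ring
      have k2 : Real.exp (n * (η / 2)) * Real.exp (-(n * (η / 2))) = 1 := by
        rw [← Real.exp_add, add_neg_cancel, Real.exp_zero]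
      have k3 := mul_le_mul_of_nonneg_right hpoly
        (show 0 ≤ Real.exp (-(n * (η / 2))) * Real.exp (n * (M - s - η)) by positivity)
      rw [k1]
      have k4 := mul_le_mul_of_nonneg_right hpoly (Real.exp_pos (-(n * (η / 2)))).le
      rw [k2] at k4
      have k5 := mul_le_mul_of_nonneg_left k4
        (show 0 ≤ Real.exp (-(n * (η / 2))) * Real.exp (n * (M - s)) by positivity)
      linarith
    have hinv : (0 : ℝ) ≤ (Real.exp (η / 2) ^ n)⁻¹ := by positivity
    have hB : gibbsMass (unionOfMatchings σ) lam (balanced (unionOfMatchings σ) δ) =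
      pairSum σ wB / partitionFunction (unionOfMatchings σ) lam := by
      refine e1.trans (congrArg (· / _) (congrArg (pairSum σ) ?_))
      funext a b
      simp only [hwB]
      split_ifs <;> rfl
    have hleft : gibbsMass (unionOfMatchings σ) lam (biasedLeft (unionOfMatchings σ) δ) =
      _ / partitionFunction (unionOfMatchings σ) lam := e2
    have hright : gibbsMass (unionOfMatchings σ) lam (biasedRight (unionOfMatchings σ) δ) =
      _ / partitionFunction (unionOfMatchings σ) lam := e3
    rw [hB, hleft, hright, mul_min_of_nonneg _ _ hinv]
    refine le_min ?_ ?_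
    · rw [← mul_div_assoc]
      exact div_le_div_of_nonneg_right (hgB.trans (mul_le_mul_of_nonneg_left (by linarith) hinv))
        hZ.le
    · rw [← mul_div_assoc]
      exact div_le_div_of_nonneg_right (hgB.trans (mul_le_mul_of_nonneg_left (by linarith) hinv))
        hZ.le

lemma asymptoticallyAlmostSurely_of_bad {Δ : ℕ}
    {Q : ∀ n, SimpleGraph (Fin n ⊕ Fin n) → Prop} (C : ℝ)
    (h : ∀ᶠ n : ℕ in Filter.atTop, ∃ bad : Finset (Fin Δ → Equiv.Perm (Fin n)),
      (bad.card : ℝ) * (n + 1) ≤ C * (n.factorial : ℝ) ^ Δ ∧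
        ∀ σ ∉ bad, Q n (unionOfMatchings σ)) :
    AsymptoticallyAlmostSurely Δ Q := by
  classical
  refine asymptoticallyAlmostSurely_of_card_le C ?_
  filter_upwards [h] with n ⟨bad, hcard, hQ⟩
  refine le_trans (mul_le_mul_of_nonneg_right (Nat.cast_le.2 (Finset.card_le_card ?_))
    (by positivity)) hcard
  intro σ hσ
  by_contra hn
  exact (Finset.mem_filter.1 hσ).2 (hQ σ hn)

/-- Phase coexistence and torpid mixing above the critical activity. -/
theorem phase_coexistence_and_torpid_mixing {Δ : ℕ} (hΔ : 3 ≤ Δ) {lam : ℝ}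
    (hlam : criticalActivity Δ < lam) :
    (∃ a δ : ℝ, 1 < a ∧ 0 < δ ∧
      AsymptoticallyAlmostSurely Δ (fun n G =>
        gibbsMass G lam (balanced G δ) ≤
          (a ^ n)⁻¹ * min (gibbsMass G lam (biasedLeft G δ))
            (gibbsMass G lam (biasedRight G δ)))) ∧
    (∃ c : ℝ, 0 < c ∧
      AsymptoticallyAlmostSurely Δ (fun n G =>
        Real.exp (c * n) ≤ (mixingTime G lam : ℝ))) := by
  have hpos : 0 < lam := (criticalActivity_pos hΔ).trans hlam
  obtain ⟨η, hη, δ, hδ, hev⟩ := card_exceptional_le hΔ hlam hpos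
  refine ⟨⟨Real.exp η, δ, Real.one_lt_exp_iff.2 hη, hδ,
    asymptoticallyAlmostSurely_of_bad 3 hev⟩, η / 2, by linarith,
    asymptoticallyAlmostSurely_of_bad 3 ?_⟩
  have h1 : ∀ᶠ n : ℕ in Filter.atTop, 1 / δ ≤ (n : ℝ) :=
    tendsto_natCast_atTop_atTop.eventually_ge_atTop _
  filter_upwards [hev, h1, Filter.eventually_gt_atTop 0,
    eventually_two_mul_pow_le_exp 1 (show 0 < η / 2 by linarith)]
    with n ⟨bad, hcard, hbad⟩ hδn hn hexp
  refine ⟨bad, hcard, fun σ hσ => ?_⟩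
  rw [div_le_iff₀ hδ, mul_comm] at hδn
  have key := mixingTime_ge_of_bottleneck (unionOfMatchings σ) hn hpos hδn (hbad σ hσ)
  rw [← div_eq_mul_inv, le_div_iff₀ (by positivity), ← Real.exp_nat_mul] at key
  have hn1 : (1 : ℝ) ≤ n := by exact_mod_cast hn
  -- Half of the exponent pays for the `1 / 4`: for `n ≥ 1` the choice of `n` gives `exp (n * (η /
  -- 2)) ≥ 2 * (n + 1) ≥ 4`.
  have e : Real.exp (n * η) = Real.exp (η / 2 * n) * Real.exp (n * (η / 2)) := by
    rw [← Real.exp_add]; congr 1; ring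
  rw [e] at key
  have := mul_le_mul_of_nonneg_left hexp (Real.exp_pos (η / 2 * n)).le
  nlinarith [Real.exp_pos (η / 2 * n)]

end Phases

end HardCore

/-! ### The theorem -/

theorem theorem3 :
    ∃ ε : ℕ → ℝ,
      (∀ Δ : ℕ, 4 ≤ Δ → 0 < ε Δ) ∧
      (∀ Δ : ℕ, 6 ≤ Δ →
        ε Δ ≥ HardCore.criticalActivity Δ - HardCore.criticalActivity (Δ + 1)) ∧
      ε 5 ≥ 0.402912 ∧
      ε 4 ≥ 0.327887 ∧
      ∀ Δ : ℕ, 4 ≤ Δ → ∀ lam : ℝ,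
        HardCore.criticalActivity Δ < lam → lam < HardCore.criticalActivity Δ + ε Δ →
        (∃ a δ : ℝ, 1 < a ∧ 0 < δ ∧
          HardCore.AsymptoticallyAlmostSurely Δ (fun n G =>
            HardCore.gibbsMass G lam (HardCore.balanced G δ) ≤
              (a ^ n)⁻¹ * min (HardCore.gibbsMass G lam (HardCore.biasedLeft G δ))
                (HardCore.gibbsMass G lam (HardCore.biasedRight G δ)))) ∧
        (∃ c : ℝ, 0 < c ∧
          HardCore.AsymptoticallyAlmostSurely Δ (fun n G =>
            Real.exp (c * n) ≤ (HardCore.mixingTime G lam : ℝ))) := by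
  -- Positivity of `criticalActivity` makes this choice exceed `1`, and also exceed the difference
  -- of consecutive critical activities.
  refine ⟨fun Δ => HardCore.criticalActivity Δ + 1, fun Δ hΔ => ?_, fun Δ hΔ => ?_, ?_, ?_,
    fun Δ hΔ lam hlam _ => HardCore.phase_coexistence_and_torpid_mixing (by omega) hlam⟩
  · have := HardCore.criticalActivity_pos (show 3 ≤ Δ by omega)
    simp only
    linarith
  · have := HardCore.criticalActivity_pos (show 3 ≤ Δ + 1 by omega)
    simp only
    linarith
  · have := HardCore.criticalActivity_pos (show 3 ≤ 5 by omega)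
    simp only
    linarith
  · have := HardCore.criticalActivity_pos (show 3 ≤ 4 by omega)
    simp only
    linarith
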